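/- Let $N\ge 3$ and let $V:(0,\infty)\to[0,\infty)$, $K:(0,\infty)\to(0,\infty)$ be continuous functions such that $V(r)\le C r^{-2}$ for all $r\in(0,1)$ and some $C>0$. Let $f:\mathbb R\to\mathbb R$ be the unique solution of $$f'(t)=\frac1{\sqrt{1+2f(t)^2}}\quad(t\in\mathbb R),\qquad f(0)=0 .$$ Let $D^{1,2}_r(\mathbb R^N)$ be the closure of the space of smooth compactly supported radial functions with respect to the norm $\|u\|_{1,2}=\left(\int_{\mathbb R^N}|\nabla u|^2dx\right)^{1/2}$ (regarded, through Sobolev's inequality, as a space of functions in $L^{2N/(N-2)}(\mathbb R^N)$ with weak gradient in $L^2$), and let $$E=\Big\{u\in D^{1,2}_r(\mathbb R^N):\int_{\mathbb R^N}V(|x|)f(u)^2dx<\infty\Big\},\qquad \|u\|=\|u\|_{1,2}+\inf_{k>0}\frac1k\Big[1+\int_{\mathbb R^N}V(|x|)f(ku)^2dx\Big].$$ Assume that there are $\alpha_0,\alpha_\infty\in\mathbb R$, $\beta_0,\beta_\infty\in[0,1]$ and $R_1,R_2>0$ such that $$\sup_{0<r<R_1}\frac{K(r)}{r^{\alpha_0}V(r)^{\beta_0}}<\infty,\qquad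 \sup_{r>R_2}\frac{K(r)}{r^{\alpha_\infty}V(r)^{\beta_\infty}}<\infty$$ (where $V(r)^0=1$ even if $V(r)=0$, and the quotient is $+\infty$ if its denominator vanishes), and let $q_1,q_2\in\mathbb R$ satisfy $$4<q_1<2\,\frac{2\alpha_0+2N-\beta_0(N+2)}{N-2},\qquad q_2>\max\Big\{4,\;4\,\frac{\alpha_\infty+N-2\beta_\infty}{N-2}\Big\}.$$ Let $g:\mathbb R\to\mathbb R$ be continuous, $G(t)=\int_0^tg(s)\,ds$, and assume that * there is $\theta>2$ such that $0\le 2\theta G(t)\le g(t)t$ for all $t\in\mathbb R$; * there is $t_0>0$ such that $G(t_0)>0$; * there is $C>0$ such that $|g(t)|\le C\min\{|t|^{q_1-1},|t|^{q_2-1}\}$ for all $t\in\mathbb R$. Then: 1. The functional $$I(u)=\frac12\int_{\mathbb R^N}|\nabla u|^2dx+\frac12\int_{\mathbb R^N}V(|x|)f(u)^2dx-\int_{\mathbb R^N}K(|x|)G(f(u))\,dx$$ is well defined on $E$ (all three integrals converge absolutely) and continuous on $(E,\|\cdot\|)$. 2. $I$ is of class $C^1$ on $E$ (in the sense of Fréchet)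 and, for all $u,h\in E$, $$I'(u)h=\int_{\mathbb R^N}\nabla u\cdot\nabla h\,dx+\int_{\mathbb R^N}V(|x|)f(u)f'(u)h\,dx-\int_{\mathbb R^N}K(|x|)g(f(u))f'(u)h\,dx,$$ where all three integrals converge absolutely. -/

import Mathlib

open MeasureTheory Set
open scoped ContDiff Gradient

/-! ### The change of variables -/

namespace QuasilinearDual

/-- Primitive of `√(1 + 2 s²)`; it is the inverse of the change of variables `f`. -/
noncomputable def changeInverse (s : ℝ) : ℝ := ∫ x in (0 : ℝ)..s, √(1 + 2 * x ^ 2)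

theorem continuous_integrand : Continuous fun x : ℝ => √(1 + 2 * x ^ 2) := by fun_prop

theorem one_le_integrand (x : ℝ) : 1 ≤ √(1 + 2 * x ^ 2) :=
  Real.one_le_sqrt.2 (by nlinarith [sq_nonneg x])

theorem integrand_pos (x : ℝ) : 0 < √(1 + 2 * x ^ 2) := zero_lt_one.trans_le (one_le_integrand x)

theorem hasDerivAt_changeInverse (s : ℝ) :
    HasDerivAt changeInverse (√(1 + 2 * s ^ 2)) s :=
  intervalIntegral.integral_hasDerivAt_right
    (continuous_integrand.intervalIntegrable _ _)
    continuous_integrand.aestronglyMeasurable.stronglyMeasurableAtFilter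
    continuous_integrand.continuousAt

theorem strictMono_changeInverse : StrictMono changeInverse :=
  strictMono_of_deriv_pos fun x => by
    rw [(hasDerivAt_changeInverse x).deriv]; exact integrand_pos x

theorem surjective_changeInverse : Function.Surjective changeInverse := by
  have hm : Monotone fun s => changeInverse s - s := by
    have hd : ∀ s, HasDerivAt (fun s => changeInverse s - s) (√(1 + 2 * s ^ 2) - 1) s :=
      fun s => (hasDerivAt_changeInverse s).sub (hasDerivAt_id s)
    refine monotone_of_deriv_nonneg (fun s => (hd s).differentiableAt) fun s => ?_
    rw [(hd s).deriv]
    linarith [one_le_integrand s]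
  have h0 : changeInverse 0 = 0 := by simp [changeInverse]
  have hc : Continuous changeInverse :=
    continuous_iff_continuousAt.2 fun s => (hasDerivAt_changeInverse s).continuousAt
  refine hc.surjective ?_ ?_
  · refine Filter.tendsto_atTop_mono' _ ?_ Filter.tendsto_id
    filter_upwards [Filter.eventually_ge_atTop 0] with s hs
    have := hm hs
    simp only [h0] at this
    simp only [id]
    linarith
  · refine Filter.tendsto_atBot_mono' _ ?_ Filter.tendsto_id
    filter_upwards [Filter.eventually_le_atBot 0] with s hs
    have := hm hs
    simp only [h0] at this
    simp only [id]
    linarith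

/-- The Cauchy problem `f' = 1 / √(1 + 2 f²)`, `f 0 = 0` has exactly one global solution. -/
theorem existsUnique_change : ∃! f : ℝ → ℝ,
    f 0 = 0 ∧ ∀ t, HasDerivAt f (1 / √(1 + 2 * f t ^ 2)) t := by
  have h0 : changeInverse 0 = 0 := by simp [changeInverse]
  let e := strictMono_changeInverse.orderIsoOfSurjective _ surjective_changeInverse
  have he : ∀ t, changeInverse (e.symm t) = t := fun t =>
    strictMono_changeInverse.orderIsoOfSurjective_self_symm_apply _ surjective_changeInverse t
  refine ⟨e.symm, ⟨?_, fun t => ?_⟩, ?_⟩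
  · exact strictMono_changeInverse.injective ((he 0).trans h0.symm)
  · rw [one_div]
    exact (hasDerivAt_changeInverse (e.symm t)).of_local_left_inverse
      e.symm.continuous.continuousAt (integrand_pos _).ne' (Filter.Eventually.of_forall he)
  · rintro f ⟨hf0, hf⟩
    have hd : ∀ t, HasDerivAt (fun t => changeInverse (f t) - t) 0 t := fun t => by
      have h := ((hasDerivAt_changeInverse (f t)).comp t (hf t)).sub (hasDerivAt_id t)
      rwa [mul_one_div, div_self (integrand_pos (f t)).ne', sub_self] at h
    have hcst := is_const_of_deriv_eq_zero (fun t => (hd t).differentiableAt) fun t => (hd t).deriv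
    funext t
    have h1 := hcst t 0
    simp only [hf0, h0, sub_zero] at h1
    exact strictMono_changeInverse.injective ((sub_eq_zero.1 h1).trans (he t).symm)

/-- The change of variables `f`: the solution of `f' = 1 / √(1 + 2 f²)` on `ℝ`, `f 0 = 0`. -/
noncomputable def dualChange : ℝ → ℝ := existsUnique_change.choose

theorem change_zero : dualChange 0 = 0 := existsUnique_change.choose_spec.1.1

theorem hasDerivAt_change (t : ℝ) : HasDerivAt dualChange (1 / √(1 + 2 * dualChange t ^ 2)) t :=
  existsUnique_change.choose_spec.1.2 t

theorem continuous_change : Continuous dualChange :=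
  continuous_iff_continuousAt.2 fun t => (hasDerivAt_change t).continuousAt

theorem monotone_change : Monotone dualChange :=
  monotone_of_deriv_nonneg (fun t => (hasDerivAt_change t).differentiableAt) fun t => by
    rw [(hasDerivAt_change t).deriv]; positivity

theorem change_neg (t : ℝ) : dualChange (-t) = -dualChange t := by
  have h : (fun t => -dualChange (-t)) = dualChange :=
    existsUnique_change.choose_spec.2 _ ⟨by simp [change_zero], fun t => by
      have := ((hasDerivAt_change (-t)).comp t (hasDerivAt_neg t)).neg
      refine this.congr_deriv ?_
      rw [neg_sq]
      ring⟩
  have h' : -dualChange (-t) = dualChange t := congrFun h t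
  linarith

theorem change_mul_le {k t : ℝ} (hk : 1 ≤ k) (ht : 0 ≤ t) : dualChange (k * t) ≤ k * dualChange t := by
  have hd : ∀ s, HasDerivAt (fun s => k * dualChange s - dualChange (k * s))
      (k * (1 / √(1 + 2 * dualChange s ^ 2)) - (1 / √(1 + 2 * dualChange (k * s) ^ 2)) * k) s := fun s =>
    ((hasDerivAt_change s).const_mul k).sub
      ((hasDerivAt_change (k * s)).comp s (by simpa using (hasDerivAt_id s).const_mul k))
  have hm : MonotoneOn (fun s => k * dualChange s - dualChange (k * s)) (Ici 0) := by
    refine monotoneOn_of_deriv_nonneg (convex_Ici 0)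
      (fun s _ => (hd s).continuousAt.continuousWithinAt)
      (fun s _ => (hd s).differentiableAt.differentiableWithinAt) fun s hs => ?_
    rw [interior_Ici] at hs
    have hs : 0 < s := hs
    rw [(hd s).deriv]
    have h1 : dualChange s ≤ dualChange (k * s) := monotone_change (by nlinarith)
    have h2 : 0 ≤ dualChange s := by simpa [change_zero] using monotone_change hs.le
    have h3 : 1 / √(1 + 2 * dualChange (k * s) ^ 2) ≤ 1 / √(1 + 2 * dualChange s ^ 2) := by
      apply one_div_le_one_div_of_le (integrand_pos _)
      gcongr
    nlinarith
  have := hm self_mem_Ici ht ht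
  simp only [mul_zero, change_zero, sub_zero] at this
  linarith

theorem convexOn_change_sq : ConvexOn ℝ univ fun t => dualChange t ^ 2 := by
  have hd : ∀ t, HasDerivAt (fun t => dualChange t ^ 2)
      (2 * dualChange t * (1 / √(1 + 2 * dualChange t ^ 2))) t := fun t => by
    simpa using (hasDerivAt_change t).fun_pow 2
  have hφ : Monotone fun s : ℝ => 2 * s * (1 / √(1 + 2 * s ^ 2)) := by
    have hφd : ∀ s : ℝ, HasDerivAt (fun s : ℝ => 2 * s * (1 / √(1 + 2 * s ^ 2)))
        (2 / (√(1 + 2 * s ^ 2)) ^ 3) s := fun s => by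
      have hp : (0 : ℝ) < 1 + 2 * s ^ 2 := by positivity
      have h1 : HasDerivAt (fun s : ℝ => 1 + 2 * s ^ 2) (4 * s) s := by
        refine (((hasDerivAt_pow 2 s).const_mul 2).const_add 1).congr_deriv ?_
        norm_num
        ring
      have h2 := (h1.sqrt hp.ne')
      have h3 := ((hasDerivAt_id s).const_mul 2).div h2 (integrand_pos s).ne'
      have hsq := Real.sq_sqrt hp.le
      have hpos := integrand_pos s
      refine (h3.congr_deriv ?_).congr_of_eventuallyEq
        (Filter.Eventually.of_forall fun x => by simp [div_eq_mul_inv])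
      simp only [id]
      field_simp
      rw [hsq]
      ring
    refine monotone_of_deriv_nonneg (fun s => (hφd s).differentiableAt) fun s => ?_
    rw [(hφd s).deriv]
    positivity
  refine Monotone.convexOn_univ_of_deriv (fun t => (hd t).differentiableAt) ?_
  have : deriv (fun t => dualChange t ^ 2) = (fun s : ℝ => 2 * s * (1 / √(1 + 2 * s ^ 2))) ∘ dualChange :=
    funext fun t => (hd t).deriv
  rw [this]
  exact hφ.comp monotone_change

theorem change_sq_abs (t : ℝ) : dualChange |t| ^ 2 = dualChange t ^ 2 := by
  rcases abs_choice t with h | h <;> simp [h, change_neg]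

theorem change_sq_le {s t : ℝ} (h : |s| ≤ |t|) : dualChange s ^ 2 ≤ dualChange t ^ 2 := by
  rw [← change_sq_abs s, ← change_sq_abs t]
  have : 0 ≤ dualChange |s| := by simpa [change_zero] using monotone_change (abs_nonneg s)
  have := monotone_change h
  gcongr

theorem change_sq_mul_le (c t : ℝ) : dualChange (c * t) ^ 2 ≤ (1 + |c|) ^ 2 * dualChange t ^ 2 := by
  have h1 : dualChange (c * t) ^ 2 ≤ dualChange ((1 + |c|) * |t|) ^ 2 := by
    apply change_sq_le
    rw [abs_mul, abs_mul, abs_abs, abs_of_nonneg (by positivity : 0 ≤ 1 + |c|)]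
    gcongr
    linarith
  have h2 := change_mul_le (k := 1 + |c|) (by linarith [abs_nonneg c]) (abs_nonneg t)
  have h3 : 0 ≤ dualChange ((1 + |c|) * |t|) := by
    simpa [change_zero] using monotone_change (by positivity : 0 ≤ (1 + |c|) * |t|)
  calc _ ≤ _ := h1
    _ ≤ ((1 + |c|) * dualChange |t|) ^ 2 := by gcongr
    _ = _ := by rw [mul_pow, change_sq_abs]

theorem change_sq_add_le (s t : ℝ) :
    dualChange (s + t) ^ 2 ≤ 9 * dualChange s ^ 2 + 9 * dualChange t ^ 2 := by
  have h := convexOn_change_sq.2 (mem_univ (2 * s)) (mem_univ (2 * t))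
    (by norm_num : (0 : ℝ) ≤ 1 / 2) (by norm_num : (0 : ℝ) ≤ 1 / 2) (by norm_num)
  simp only [smul_eq_mul] at h
  have e : 1 / 2 * (2 * s) + 1 / 2 * (2 * t) = s + t := by ring
  rw [e] at h
  have h1 := change_sq_mul_le 2 s
  have h2 := change_sq_mul_le 2 t
  norm_num at h1 h2
  nlinarith [sq_nonneg (dualChange s), sq_nonneg (dualChange t)]

/-! ### The radial homogeneous Sobolev space -/

/-- The critical Sobolev exponent `2* = 2N / (N - 2)`. -/
noncomputable def sobolevExponent (N : ℕ) : ENNReal :=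
  ENNReal.ofReal (2 * (N : ℝ) / ((N : ℝ) - 2))

instance sobolevExponent_fact (N : ℕ) [hN : Fact (3 ≤ N)] : Fact (1 ≤ sobolevExponent N) := by
  refine ⟨?_⟩
  have h : (3 : ℝ) ≤ N := by exact_mod_cast hN.out
  rw [sobolevExponent, ENNReal.one_le_ofReal, le_div_iff₀ (by linarith)]
  linarith

/-- `C^∞_{c,r}(ℝ^N)`: smooth, compactly supported, radial real functions. -/
def radialTestFunctions (N : ℕ) : Submodule ℝ (EuclideanSpace ℝ (Fin N) → ℝ) where
  carrier := {φ | ContDiff ℝ ∞ φ ∧ HasCompactSupport φ ∧ ∀ x y, ‖x‖ = ‖y‖ → φ x = φ y}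
  zero_mem' := ⟨contDiff_const, HasCompactSupport.zero, fun _ _ _ => rfl⟩
  add_mem' := fun {_ _} hφ hψ => ⟨hφ.1.add hψ.1, hφ.2.1.add hψ.2.1, fun x y h => by
    simp only [Pi.add_apply, hφ.2.2 x y h, hψ.2.2 x y h]⟩
  smul_mem' := fun c _ hφ => ⟨hφ.1.const_smul c, hφ.2.1.smul_left (f := fun _ => c), fun x y h => by
    simp only [Pi.smul_apply, hφ.2.2 x y h]⟩

theorem gradient_add_of_differentiable {N : ℕ} {φ ψ : EuclideanSpace ℝ (Fin N) → ℝ}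
    (hφ : Differentiable ℝ φ) (hψ : Differentiable ℝ ψ) : ∇ (φ + ψ) = ∇ φ + ∇ ψ := by
  funext x
  simp [gradient, fderiv_add (hφ x) (hψ x)]

theorem gradient_smul_of_differentiable {N : ℕ} {φ : EuclideanSpace ℝ (Fin N) → ℝ} (c : ℝ)
    (hφ : Differentiable ℝ φ) : ∇ (c • φ) = c • ∇ φ := by
  funext x
  simp [gradient, fderiv_const_smul (hφ x)]

/-- The pairs `(φ, ∇φ)`, `φ ∈ C^∞_{c,r}(ℝ^N)`, in `L^{2*}(ℝ^N) × L²(ℝ^N; ℝ^N)`. -/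
noncomputable def radialTestGraph (N : ℕ) [Fact (3 ≤ N)] :
    Submodule ℝ (Lp ℝ (sobolevExponent N) (volume : Measure (EuclideanSpace ℝ (Fin N))) ×
      Lp (EuclideanSpace ℝ (Fin N)) 2 (volume : Measure (EuclideanSpace ℝ (Fin N)))) where
  carrier := {w | ∃ φ ∈ radialTestFunctions N, w.1 =ᵐ[volume] φ ∧ w.2 =ᵐ[volume] ∇ φ}
  zero_mem' := ⟨0, zero_mem _, Lp.coeFn_zero _ _ _, by
    have : ∇ (0 : EuclideanSpace ℝ (Fin N) → ℝ) = 0 := by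
      funext x
      simp [gradient]
    rw [this]
    exact Lp.coeFn_zero _ _ _⟩
  add_mem' := by
    rintro v w ⟨φ, hφ, h1, h2⟩ ⟨ψ, hψ, h3, h4⟩
    refine ⟨φ + ψ, add_mem hφ hψ, (Lp.coeFn_add _ _).trans (h1.add h3), ?_⟩
    rw [gradient_add_of_differentiable (hφ.1.differentiable (by simp))
      (hψ.1.differentiable (by simp))]
    exact (Lp.coeFn_add _ _).trans (h2.add h4)
  smul_mem' := by
    rintro c w ⟨φ, hφ, h1, h2⟩
    refine ⟨c • φ, Submodule.smul_mem _ c hφ, (Lp.coeFn_smul _ _).trans (h1.const_smul c), ?_⟩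
    rw [gradient_smul_of_differentiable c (hφ.1.differentiable (by simp))]
    exact (Lp.coeFn_smul _ _).trans (h2.const_smul c)

/-- `D_r^{1,2}(ℝ^N)`: the closure of `C^∞_{c,r}(ℝ^N)` with respect to `(∫ |∇u|²)^{1/2}`.
An element is a pair `w = (u, ∇u)`, with `u ∈ L^{2*}` and `∇u ∈ L²` the weak gradient of `u`
(`D12r_integral_grad`), so that it is determined by `u` (`D12r_ext`). By Sobolev's inequality
(`D12r_norm_le`) convergence of `∇u` in `L²` entails that of `u` in `L^{2*}`, so that the closure
of the pairs `(φ, ∇φ)` for the product norm is their closure for the gradient norm. -/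
noncomputable def D12r (N : ℕ) [Fact (3 ≤ N)] :
    Submodule ℝ (Lp ℝ (sobolevExponent N) (volume : Measure (EuclideanSpace ℝ (Fin N))) ×
      Lp (EuclideanSpace ℝ (Fin N)) 2 (volume : Measure (EuclideanSpace ℝ (Fin N)))) :=
  (radialTestGraph N).topologicalClosure

/-- Sobolev's inequality on `D_r^{1,2}`. -/
theorem D12r_norm_le (N : ℕ) [hN : Fact (3 ≤ N)] :
    ∃ C : ℝ, ∀ w ∈ D12r N, ‖w.1‖ ≤ C * ‖w.2‖ := by
  have h3 : (3 : ℝ) ≤ N := by exact_mod_cast hN.out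
  let C : NNReal := eLpNormLESNormFDerivOfEqInnerConst
    (volume : Measure (EuclideanSpace ℝ (Fin N))) ((2 : NNReal) : ℝ)
  refine ⟨C, fun w hw => ?_⟩
  have hcl : IsClosed {w : Lp ℝ (sobolevExponent N)
      (volume : Measure (EuclideanSpace ℝ (Fin N))) ×
      Lp (EuclideanSpace ℝ (Fin N)) 2 (volume : Measure (EuclideanSpace ℝ (Fin N))) |
      ‖w.1‖ ≤ C * ‖w.2‖} :=
    isClosed_le (by fun_prop) (by fun_prop)
  refine closure_minimal ?_ hcl hw
  rintro w ⟨φ, hφ, h1, h2⟩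
  have hS := eLpNorm_le_eLpNorm_fderiv_of_eq_inner
    (volume : Measure (EuclideanSpace ℝ (Fin N))) (u := φ) (hφ.1.of_le (by simp)) hφ.2.1
    (p := 2) (p' := (2 * (N : ℝ) / ((N : ℝ) - 2)).toNNReal) (by norm_num)
    (by rw [finrank_euclideanSpace_fin]; have := hN.out; omega)
    (by
      have : (0 : ℝ) < N - 2 := by linarith
      rw [finrank_euclideanSpace_fin, Real.coe_toNNReal _ (by positivity)]
      have : (N : ℝ) ≠ 0 := by linarith
      push_cast
      field_simp)
  have hg : eLpNorm (fderiv ℝ φ) ((2 : NNReal) : ENNReal) volume = eLpNorm (∇ φ) 2 volume := by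
    refine eLpNorm_congr_norm_ae (Filter.Eventually.of_forall fun x => ?_)
    simp [gradient]
  rw [hg] at hS
  simp only [mem_ofPred_eq, Lp.norm_def]
  rw [eLpNorm_congr_ae h1, eLpNorm_congr_ae h2, ← ENNReal.coe_toReal C, ← ENNReal.toReal_mul]
  refine ENNReal.toReal_mono (ENNReal.mul_ne_top ENNReal.coe_ne_top ?_) hS
  rw [← eLpNorm_congr_ae h2]
  exact Lp.eLpNorm_ne_top _


/-- For `w = (u, ∇u)` in `D_r^{1,2}`, the second component is the weak gradient of the first. -/
theorem D12r_integral_grad {N : ℕ} [hN : Fact (3 ≤ N)] {w} (hw : w ∈ D12r N)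
    {ψ : EuclideanSpace ℝ (Fin N) → ℝ} (hψ : ContDiff ℝ ∞ ψ) (hψc : HasCompactSupport ψ)
    (v : EuclideanSpace ℝ (Fin N)) :
    ∫ x, w.1 x * fderiv ℝ ψ x v = -∫ x, inner ℝ v (w.2 x) * ψ x := by
  have hfc : Continuous fun x => fderiv ℝ ψ x v :=
    (hψ.continuous_fderiv (by simp)).clm_apply continuous_const
  have hfs : HasCompactSupport fun x => fderiv ℝ ψ x v := hψc.fderiv_apply ℝ v
  have : ENNReal.HolderConjugate (sobolevExponent N) (1 - (sobolevExponent N)⁻¹)⁻¹ :=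
    ENNReal.HolderConjugate.inv_one_sub_inv' Fact.out
  have : Fact (1 ≤ (1 - (sobolevExponent N)⁻¹)⁻¹) := ⟨by simp⟩
  have m1 : MemLp (fun x => fderiv ℝ ψ x v) (1 - (sobolevExponent N)⁻¹)⁻¹ volume :=
    hfc.memLp_of_hasCompactSupport hfs
  have m2 : MemLp ψ 2 (volume : Measure (EuclideanSpace ℝ (Fin N))) :=
    hψ.continuous.memLp_of_hasCompactSupport hψc
  let B : EuclideanSpace ℝ (Fin N) →L[ℝ] ℝ →L[ℝ] ℝ :=
    (ContinuousLinearMap.mul ℝ ℝ).comp (innerSL ℝ v)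
  have e1 : ∀ u : Lp ℝ (sobolevExponent N) (volume : Measure (EuclideanSpace ℝ (Fin N))),
      (ContinuousLinearMap.mul ℝ ℝ).lpPairing volume _ _ u m1.toLp =
        ∫ x, u x * fderiv ℝ ψ x v := fun u => by
    rw [ContinuousLinearMap.lpPairing_eq_integral]
    refine integral_congr_ae ?_
    filter_upwards [m1.coeFn_toLp] with x hx
    simp [hx]
  have e2 : ∀ G : Lp (EuclideanSpace ℝ (Fin N)) 2
      (volume : Measure (EuclideanSpace ℝ (Fin N))),
      B.lpPairing volume 2 2 G m2.toLp = ∫ x, inner ℝ v (G x) * ψ x := fun G => by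
    rw [ContinuousLinearMap.lpPairing_eq_integral]
    refine integral_congr_ae ?_
    filter_upwards [m2.coeFn_toLp] with x hx
    simp [hx, B]
  rw [← e1, ← e2]
  have hcl : IsClosed {w : Lp ℝ (sobolevExponent N)
      (volume : Measure (EuclideanSpace ℝ (Fin N))) ×
      Lp (EuclideanSpace ℝ (Fin N)) 2 (volume : Measure (EuclideanSpace ℝ (Fin N))) |
      (ContinuousLinearMap.mul ℝ ℝ).lpPairing volume _ _ w.1 m1.toLp =
        -B.lpPairing volume 2 2 w.2 m2.toLp} :=
    isClosed_eq
      ((((ContinuousLinearMap.mul ℝ ℝ).lpPairing volume _ _).flip m1.toLp).continuous.comp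
        continuous_fst)
      (((B.lpPairing volume 2 2).flip m2.toLp).continuous.comp continuous_snd).neg
  refine closure_minimal ?_ hcl hw
  rintro w ⟨φ, hφ, h1, h2⟩
  rw [mem_ofPred_eq, e1, e2]
  have hdφ : Continuous fun x => fderiv ℝ φ x v :=
    (hφ.1.continuous_fderiv (by simp)).clm_apply continuous_const
  have h := integral_mul_fderiv_eq_neg_fderiv_mul_of_integrable (f := φ) (g := ψ) (v := v)
    (μ := volume)
    ((hdφ.mul hψ.continuous).integrable_of_hasCompactSupport hψc.mul_left)
    ((hφ.1.continuous.mul hfc).integrable_of_hasCompactSupport hfs.mul_left)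
    ((hφ.1.continuous.mul hψ.continuous).integrable_of_hasCompactSupport hψc.mul_left)
    (fun x _ => hφ.1.differentiable (by simp) x) (fun x _ => hψ.differentiable (by simp) x)
  have a1 : ∫ x, w.1 x * fderiv ℝ ψ x v = ∫ x, φ x * fderiv ℝ ψ x v :=
    integral_congr_ae (by filter_upwards [h1] with x hx; rw [hx])
  have a2 : ∫ x, inner ℝ v (w.2 x) * ψ x = ∫ x, fderiv ℝ φ x v * ψ x :=
    integral_congr_ae (by
      filter_upwards [h2] with x hx
      rw [hx, real_inner_comm, gradient, InnerProductSpace.toDual_symm_apply])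
  rw [a1, a2, h]

/-- An element of `D_r^{1,2}` is determined by its function `u`. -/
theorem D12r_ext {N : ℕ} [hN : Fact (3 ≤ N)] {w w' : D12r N} (h : w.1.1 = w'.1.1) : w = w' := by
  suffices hz : ∀ z ∈ D12r N, z.1 = 0 → z.2 = 0 by
    have := hz (w.1 - w'.1) (sub_mem w.2 w'.2) (by simp [h])
    exact Subtype.ext (Prod.ext h (sub_eq_zero.1 this))
  intro z hz h0
  have hloc : LocallyIntegrable z.2 (volume : Measure (EuclideanSpace ℝ (Fin N))) :=
    (Lp.memLp z.2).locallyIntegrable (by norm_num)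
  have hv : ∀ v : EuclideanSpace ℝ (Fin N), ∀ᵐ x, inner ℝ v (z.2 x) = 0 := fun v => by
    have hl : LocallyIntegrable (fun x => inner ℝ v (z.2 x)) volume :=
      ((Lp.memLp z.2).const_inner v).locallyIntegrable (by norm_num)
    refine ae_eq_zero_of_integral_contDiff_smul_eq_zero hl fun ψ hψ hψc => ?_
    have := D12r_integral_grad hz hψ hψc v
    have e : ∫ x, z.1 x * fderiv ℝ ψ x v = 0 := by
      rw [h0]
      refine integral_eq_zero_of_ae ?_
      filter_upwards [Lp.coeFn_zero ℝ (sobolevExponent N)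
        (volume : Measure (EuclideanSpace ℝ (Fin N)))] with x hx
      rw [hx]
      simp
    rw [e] at this
    have := (neg_eq_zero.1 this.symm)
    simpa [mul_comm] using this
  rw [Lp.eq_zero_iff_ae_eq_zero]
  have : ∀ᵐ x, ∀ i : Fin N, inner ℝ (EuclideanSpace.single i (1 : ℝ)) (z.2 x) = 0 :=
    ae_all_iff.2 fun i => hv _
  filter_upwards [this] with x hx
  ext i
  have h := hx i
  rw [EuclideanSpace.inner_single_left] at h
  simpa using h

/-! ### The Orlicz-Sobolev space -/

/-- The measure `V(|x|) dx` on `ℝ^N`. -/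
noncomputable def radialMeasure (N : ℕ) (V : ℝ → ℝ) : Measure (EuclideanSpace ℝ (Fin N)) :=
  volume.withDensity fun x => ENNReal.ofReal (V ‖x‖)

theorem radialMeasure_ac (N : ℕ) (V : ℝ → ℝ) : radialMeasure N V ≪ volume :=
  withDensity_absolutelyContinuous _ _

/-- The functions `u ∈ D_r^{1,2}` with `∫ V(|x|) f(u)² dx < ∞`. -/
noncomputable def orliczSobolevSubmodule (N : ℕ) [Fact (3 ≤ N)] (V : ℝ → ℝ) :
    Submodule ℝ (D12r N) where
  carrier := {w | ∫⁻ x, ENNReal.ofReal (dualChange (w.1.1 x) ^ 2) ∂radialMeasure N V < ⊤}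
  zero_mem' := by
    have : (fun x => ENNReal.ofReal (dualChange ((0 : D12r N).1.1 x) ^ 2)) =ᵐ[radialMeasure N V] 0 := by
      filter_upwards [(radialMeasure_ac N V).ae_le (Lp.coeFn_zero ℝ (sobolevExponent N)
        (volume : Measure (EuclideanSpace ℝ (Fin N))))] with x hx
      simp only [Submodule.coe_zero, Prod.fst_zero, hx, Pi.zero_apply, change_zero]
      simp
    rw [mem_ofPred_eq, lintegral_congr_ae this]
    simp
  add_mem' := by
    intro v w hv hw
    have hvw : ∀ᵐ x ∂radialMeasure N V,
        ENNReal.ofReal (dualChange ((v + w).1.1 x) ^ 2) ≤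
          9 * ENNReal.ofReal (dualChange (v.1.1 x) ^ 2) +
            9 * ENNReal.ofReal (dualChange (w.1.1 x) ^ 2) := by
      filter_upwards [(radialMeasure_ac N V).ae_le (Lp.coeFn_add v.1.1 w.1.1)] with x hx
      have e : (v + w).1.1 x = v.1.1 x + w.1.1 x := hx
      rw [e]
      refine (ENNReal.ofReal_le_ofReal (change_sq_add_le _ _)).trans (le_of_eq ?_)
      rw [ENNReal.ofReal_add (by positivity) (by positivity), ENNReal.ofReal_mul (by norm_num),
        ENNReal.ofReal_mul (by norm_num)]
      norm_num
    have hm : AEMeasurable (fun x => 9 * ENNReal.ofReal (dualChange (v.1.1 x) ^ 2))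
        (radialMeasure N V) := by
      have := (Lp.aestronglyMeasurable v.1.1).aemeasurable.mono_ac (radialMeasure_ac N V)
      exact (((continuous_change.measurable.comp_aemeasurable this).pow_const 2).ennreal_ofReal).const_mul 9
    refine (lintegral_mono_ae hvw).trans_lt ?_
    rw [lintegral_add_left' hm, lintegral_const_mul' _ _ (by norm_num),
      lintegral_const_mul' _ _ (by norm_num)]
    exact ENNReal.add_lt_top.2 ⟨ENNReal.mul_lt_top (by norm_num) hv,
      ENNReal.mul_lt_top (by norm_num) hw⟩
  smul_mem' := by
    intro c w hw
    have hcw : ∀ᵐ x ∂radialMeasure N V,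
        ENNReal.ofReal (dualChange ((c • w).1.1 x) ^ 2) ≤
          ENNReal.ofReal ((1 + |c|) ^ 2) * ENNReal.ofReal (dualChange (w.1.1 x) ^ 2) := by
      filter_upwards [(radialMeasure_ac N V).ae_le (Lp.coeFn_smul c w.1.1)] with x hx
      have e : (c • w).1.1 x = c * w.1.1 x := hx
      rw [e, ← ENNReal.ofReal_mul (by positivity)]
      exact ENNReal.ofReal_le_ofReal (change_sq_mul_le _ _)
    refine (lintegral_mono_ae hcw).trans_lt ?_
    rw [lintegral_const_mul' _ _ (by simp)]
    exact ENNReal.mul_lt_top (by simp) hw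

/-- The space `E = {u ∈ D_r^{1,2}(ℝ^N) : ∫ V(|x|) f(u)² dx < ∞}`, normed below. -/
def OrliczSobolev (N : ℕ) [Fact (3 ≤ N)] (V : ℝ → ℝ) : Type := orliczSobolevSubmodule N V

namespace OrliczSobolev

variable {N : ℕ} [Fact (3 ≤ N)] {V : ℝ → ℝ}

noncomputable instance : AddCommGroup (OrliczSobolev N V) :=
  inferInstanceAs (AddCommGroup (orliczSobolevSubmodule N V))

noncomputable instance : Module ℝ (OrliczSobolev N V) :=
  inferInstanceAs (Module ℝ (orliczSobolevSubmodule N V))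

/-- The function `u : ℝ^N → ℝ` (a representative of it). -/
noncomputable def fn (u : OrliczSobolev N V) : EuclideanSpace ℝ (Fin N) → ℝ := u.1.1.1

/-- The weak gradient `∇u : ℝ^N → ℝ^N`. -/
noncomputable def grad (u : OrliczSobolev N V) :
    EuclideanSpace ℝ (Fin N) → EuclideanSpace ℝ (Fin N) := u.1.1.2

/-- The norm `‖u‖_{1,2} = (∫ |∇u|² dx)^{1/2}`. -/
noncomputable def gradNorm (u : OrliczSobolev N V) : ℝ := √(∫ x, ‖u.grad x‖ ^ 2)

/-- The quantity `(1/k) (1 + ∫ V(|x|) f(k u)² dx)`. -/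
noncomputable def amemiya (u : OrliczSobolev N V) (k : ℝ) : ℝ :=
  1 / k * (1 + ∫ x, dualChange (k * u.fn x) ^ 2 ∂radialMeasure N V)

/-- The Orlicz norm `‖u‖_o = inf_{k > 0} (1/k) (1 + ∫ V(|x|) f(k u)² dx)`. -/
noncomputable def orliczNorm (u : OrliczSobolev N V) : ℝ := ⨅ k : Ioi (0 : ℝ), u.amemiya k

/-- `‖u‖ = ‖u‖_{1,2} + ‖u‖_o`. -/
noncomputable instance : Norm (OrliczSobolev N V) := ⟨fun u => u.gradNorm + u.orliczNorm⟩

theorem norm_def (u : OrliczSobolev N V) : ‖u‖ = u.gradNorm + u.orliczNorm := rfl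

theorem fn_add (u v : OrliczSobolev N V) : (u + v).fn =ᵐ[volume] u.fn + v.fn :=
  Lp.coeFn_add u.1.1.1 v.1.1.1

theorem fn_smul (c : ℝ) (u : OrliczSobolev N V) : (c • u).fn =ᵐ[volume] c • u.fn :=
  Lp.coeFn_smul c u.1.1.1

theorem fn_zero : (0 : OrliczSobolev N V).fn =ᵐ[volume] 0 := Lp.coeFn_zero _ _ _

theorem gradNorm_eq (u : OrliczSobolev N V) : u.gradNorm = ‖u.1.1.2‖ := by
  rw [gradNorm, ← Real.sqrt_sq (norm_nonneg u.1.1.2), ← real_inner_self_eq_norm_sq,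
    L2.inner_def]
  simp only [real_inner_self_eq_norm_sq]
  rfl

theorem integrable_change_sq (u : OrliczSobolev N V) :
    Integrable (fun x => dualChange (u.fn x) ^ 2) (radialMeasure N V) := by
  have h := (Lp.aestronglyMeasurable u.1.1.1).mono_ac (radialMeasure_ac N V)
  refine ⟨(continuous_change.pow 2).comp_aestronglyMeasurable h, ?_⟩
  rw [hasFiniteIntegral_iff_ofReal (Filter.Eventually.of_forall fun x => sq_nonneg _)]
  exact u.2

theorem integrable_change_mul_sq (u : OrliczSobolev N V) (k : ℝ) :
    Integrable (fun x => dualChange (k * u.fn x) ^ 2) (radialMeasure N V) := by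
  refine (integrable_change_sq (k • u)).congr ?_
  filter_upwards [(radialMeasure_ac N V).ae_le (fn_smul k u)] with x hx
  rw [hx]
  rfl

theorem amemiya_nonneg (u : OrliczSobolev N V) {k : ℝ} (hk : 0 < k) : 0 ≤ u.amemiya k := by
  have : 0 ≤ ∫ x, dualChange (k * u.fn x) ^ 2 ∂radialMeasure N V :=
    integral_nonneg fun x => sq_nonneg _
  unfold amemiya
  positivity

theorem orliczNorm_nonneg (u : OrliczSobolev N V) : 0 ≤ u.orliczNorm :=
  Real.iInf_nonneg fun k => u.amemiya_nonneg k.2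

theorem orliczNorm_le (u : OrliczSobolev N V) {k : ℝ} (hk : 0 < k) :
    u.orliczNorm ≤ u.amemiya k :=
  ciInf_le (f := fun k : Ioi (0 : ℝ) => u.amemiya k)
    ⟨0, by rintro _ ⟨k, rfl⟩; exact u.amemiya_nonneg k.2⟩ ⟨k, hk⟩

theorem orliczNorm_zero : (0 : OrliczSobolev N V).orliczNorm = 0 := by
  refine le_antisymm (le_of_forall_pos_le_add fun ε hε => ?_) (orliczNorm_nonneg _)
  refine (orliczNorm_le 0 (inv_pos.2 hε)).trans (le_of_eq ?_)
  have : ∫ x, dualChange (ε⁻¹ * (0 : OrliczSobolev N V).fn x) ^ 2 ∂radialMeasure N V = 0 := by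
    refine integral_eq_zero_of_ae ?_
    filter_upwards [(radialMeasure_ac N V).ae_le fn_zero] with x hx
    rw [hx, Pi.zero_apply, mul_zero, change_zero]
    simp
  rw [amemiya, this]
  simp

theorem orliczNorm_smul_le (c : ℝ) (u : OrliczSobolev N V) :
    (c • u).orliczNorm ≤ |c| * u.orliczNorm := by
  rcases eq_or_ne c 0 with rfl | hc
  · simp [orliczNorm_zero]
  have hc' := abs_pos.2 hc
  have : Nonempty (Ioi (0 : ℝ)) := ⟨⟨1, mem_Ioi.2 one_pos⟩⟩
  rw [← div_le_iff₀' hc']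
  refine le_ciInf fun ⟨k, hk⟩ => ?_
  have hk : 0 < k := hk
  rw [div_le_iff₀' hc']
  refine (orliczNorm_le _ (div_pos hk hc')).trans (le_of_eq ?_)
  have : ∫ x, dualChange (k / |c| * (c • u).fn x) ^ 2 ∂radialMeasure N V =
      ∫ x, dualChange (k * u.fn x) ^ 2 ∂radialMeasure N V := by
    refine integral_congr_ae ?_
    filter_upwards [(radialMeasure_ac N V).ae_le (fn_smul c u)] with x hx
    rw [hx, ← change_sq_abs, ← change_sq_abs (k * _)]
    congr 2
    simp only [Pi.smul_apply, smul_eq_mul, abs_mul, abs_div, abs_abs]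
    field_simp
  rw [amemiya, this, amemiya]
  field_simp

theorem orliczNorm_add_le (u v : OrliczSobolev N V) :
    (u + v).orliczNorm ≤ u.orliczNorm + v.orliczNorm := by
  have : Nonempty (Ioi (0 : ℝ)) := ⟨⟨1, mem_Ioi.2 one_pos⟩⟩
  refine le_ciInf_add_ciInf fun ⟨k, hk⟩ ⟨l, hl⟩ => ?_
  have hk : 0 < k := hk
  have hl : 0 < l := hl
  have hm : 0 < k * l / (k + l) := by positivity
  refine (orliczNorm_le _ hm).trans ?_
  have key : ∫ x, dualChange (k * l / (k + l) * (u + v).fn x) ^ 2 ∂radialMeasure N V ≤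
      ∫ x, (l / (k + l) * dualChange (k * u.fn x) ^ 2 +
        k / (k + l) * dualChange (l * v.fn x) ^ 2) ∂radialMeasure N V := by
    refine integral_mono_ae (integrable_change_mul_sq _ _)
      (((integrable_change_mul_sq u k).const_mul _).add
        ((integrable_change_mul_sq v l).const_mul _)) ?_
    filter_upwards [(radialMeasure_ac N V).ae_le (fn_add u v)] with x hx
    have h := convexOn_change_sq.2 (mem_univ (k * u.fn x)) (mem_univ (l * v.fn x))
      (by positivity : 0 ≤ l / (k + l)) (by positivity : 0 ≤ k / (k + l))
      (by field_simp; ring)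
    simp only [smul_eq_mul] at h
    have e : k * l / (k + l) * (u + v).fn x =
        l / (k + l) * (k * u.fn x) + k / (k + l) * (l * v.fn x) := by
      rw [hx, Pi.add_apply]
      field_simp
    rw [e]
    exact h
  rw [integral_add ((integrable_change_mul_sq u k).const_mul _)
    ((integrable_change_mul_sq v l).const_mul _), integral_const_mul, integral_const_mul] at key
  simp only [amemiya]
  have := mul_le_mul_of_nonneg_left key (by positivity : 0 ≤ 1 / (k * l / (k + l)))
  calc _ = 1 / (k * l / (k + l)) + 1 / (k * l / (k + l)) *
        ∫ x, dualChange (k * l / (k + l) * (u + v).fn x) ^ 2 ∂radialMeasure N V := by ring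
    _ ≤ 1 / (k * l / (k + l)) + 1 / (k * l / (k + l)) *
        (l / (k + l) * ∫ x, dualChange (k * u.fn x) ^ 2 ∂radialMeasure N V +
          k / (k + l) * ∫ x, dualChange (l * v.fn x) ^ 2 ∂radialMeasure N V) := by gcongr
    _ = _ := by
      field_simp
      ring

theorem normCore : NormedSpace.Core ℝ (OrliczSobolev N V) where
  norm_nonneg u := add_nonneg (Real.sqrt_nonneg _) u.orliczNorm_nonneg
  norm_smul c u := by
    have hg : (c • u).gradNorm = |c| * u.gradNorm := by
      rw [gradNorm_eq, gradNorm_eq]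
      exact norm_smul c u.1.1.2
    have ho : (c • u).orliczNorm = |c| * u.orliczNorm := by
      refine le_antisymm (orliczNorm_smul_le c u) ?_
      rcases eq_or_ne c 0 with rfl | hc
      · simp [orliczNorm_zero]
      have := orliczNorm_smul_le c⁻¹ (c • u)
      rw [inv_smul_smul₀ hc, abs_inv] at this
      exact (le_inv_mul_iff₀ (abs_pos.2 hc)).1 this
    rw [norm_def, norm_def, hg, ho, Real.norm_eq_abs]
    ring
  norm_triangle u v := by
    have hg : (u + v).gradNorm ≤ u.gradNorm + v.gradNorm := by
      rw [gradNorm_eq, gradNorm_eq, gradNorm_eq]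
      exact norm_add_le u.1.1.2 v.1.1.2
    rw [norm_def, norm_def, norm_def]
    linarith [orliczNorm_add_le u v]
  norm_eq_zero_iff u := by
    constructor
    · intro h
      have hg : u.gradNorm = 0 :=
        le_antisymm (by rw [norm_def] at h; linarith [u.orliczNorm_nonneg]) (Real.sqrt_nonneg _)
      rw [gradNorm_eq] at hg
      obtain ⟨C, hC⟩ := D12r_norm_le N
      have h1 := hC u.1.1 u.1.2
      rw [hg, mul_zero] at h1
      have h1 : u.1.1.1 = 0 := norm_le_zero_iff.1 h1
      exact Subtype.ext (Subtype.ext (Prod.ext h1 (norm_eq_zero.1 hg)))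
    · rintro rfl
      rw [norm_def, orliczNorm_zero, gradNorm_eq, add_zero]
      exact norm_zero

noncomputable instance : NormedAddCommGroup (OrliczSobolev N V) :=
  NormedAddCommGroup.ofCore normCore

noncomputable instance : NormedSpace ℝ (OrliczSobolev N V) := NormedSpace.ofCore normCore

end OrliczSobolev

/-! ### The functional -/

/-- `G(t) = ∫₀ᵗ g(s) ds`. -/
noncomputable def primitive (g : ℝ → ℝ) (t : ℝ) : ℝ := ∫ s in (0 : ℝ)..t, g s

/-- `I(u) = ½ ∫ |∇u|² dx + ½ ∫ V(|x|) f(u)² dx - ∫ K(|x|) G(f(u)) dx` on `E`. -/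
noncomputable def energy {N : ℕ} [Fact (3 ≤ N)] (V K g : ℝ → ℝ) (u : OrliczSobolev N V) : ℝ :=
  1 / 2 * (∫ x, ‖u.grad x‖ ^ 2) + 1 / 2 * (∫ x, V ‖x‖ * dualChange (u.fn x) ^ 2) -
    ∫ x, K ‖x‖ * primitive g (dualChange (u.fn x))

/-- `q_0^*(α, β) = (2α + 2N - β(N + 2)) / (N - 2)`. -/
noncomputable def qZero (N : ℕ) (α β : ℝ) : ℝ :=
  (2 * α + 2 * N - β * (N + 2)) / ((N : ℝ) - 2)

/-- `q_∞^*(α, β) = 2 (α + N - 2β) / (N - 2)`. -/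
noncomputable def qInfty (N : ℕ) (α β : ℝ) : ℝ := 2 * ((α + N - 2 * β) / ((N : ℝ) - 2))

end QuasilinearDual

open QuasilinearDual

namespace QuasilinearDual

open Filter Topology

/-! ### Elementary properties of the change of variables -/

/-! The gradient term is a continuous quadratic form, so everything rests on functionals `u ↦ ∫
W(|x|) Φ(u) dx`, taken with `W = V`, `Φ = f²/2` and with `W = K`, `Φ = G ∘ f`. `AdmissibleIntegrand`
isolates the pointwise inequalities that make such a functional C¹, and both terms are instances.

Two facts turn the norm of `E` into pointwise and integral control. Radial functions decay, `|u(x)|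
≤ c ‖u‖ |x|^(-κ)` with `κ = (N-2)/2` (`exists_abs_fn_le`), and the modular `∫ V f(u)²` is at most
`‖u‖` when `‖u‖ < 1` (`integral_mul_change_sq_le`). Hence `W |φ(u)| |k|`, with `φ = Φ'`, is
dominated by an integrable weight plus `V f(u)² + V f(k)²`. An increment `v` changes `φ(u)` by an
amount whose integral against `|k|` is at most a small multiple of a fixed quantity plus `D ∫ V
f(v)² ≤ D ‖v‖` (`exists_small_oscillation`). This one estimate yields Fréchet differentiability,
through the mean value theorem, and continuity of the differential, with no extraction of
subsequences in `E`.

For the nonlinear term, near the origin `V ≤ C r^(-2)` bounds `K` by a power of `r`, while `|f| f' ≤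
1` and `f² ≤ 2|t|` make `g(f) f'` grow only like `|u|^(q₁/2 - 1)`; this halving is why the bound on
`q₁` carries a factor 2 (`exists_near_bound`). Near infinity `u` is bounded, so `u² ≤ c f(u)²`, and
weighted AM-GM divides the integrand between `V |u| |k|` and the integrable weight
(`exists_far_bound`). On the annulus between, compactness suffices (`AdmissibleIntegrand.of_tails`).
-/

theorem deriv_change (t : ℝ) : deriv dualChange t = 1 / √(1 + 2 * dualChange t ^ 2) :=
  (hasDerivAt_change t).deriv

theorem continuous_deriv_change : Continuous (deriv dualChange) := by
  have h : deriv dualChange = fun t => 1 / √(1 + 2 * dualChange t ^ 2) := funext deriv_change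
  rw [h]
  have hc := continuous_change
  exact Continuous.div continuous_const (by fun_prop) fun t => (integrand_pos _).ne'

theorem deriv_change_pos (t : ℝ) : 0 < deriv dualChange t := by
  rw [deriv_change]
  exact one_div_pos.2 (integrand_pos _)

theorem deriv_change_le_one (t : ℝ) : deriv dualChange t ≤ 1 := by
  rw [deriv_change, div_le_one (integrand_pos _)]
  exact one_le_integrand _

theorem abs_change_mul_deriv_le_one (t : ℝ) : |dualChange t| * deriv dualChange t ≤ 1 := by
  rw [deriv_change, mul_one_div, div_le_one (integrand_pos _)]
  exact Real.abs_le_sqrt (by nlinarith [sq_nonneg (dualChange t)])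

theorem abs_change_le (t : ℝ) : |dualChange t| ≤ |t| := by
  have h := Convex.norm_image_sub_le_of_norm_deriv_le (f := dualChange) (C := 1) (s := univ)
    (x := 0) (y := t) (fun x _ => (hasDerivAt_change x).differentiableAt)
    (fun x _ => by
      rw [Real.norm_eq_abs, abs_of_pos (deriv_change_pos x)]
      exact deriv_change_le_one x) convex_univ (mem_univ _) (mem_univ _)
  simpa [change_zero] using h

theorem hasDerivAt_half_change_sq (t : ℝ) :
    HasDerivAt (fun t => 1 / 2 * dualChange t ^ 2) (dualChange t * deriv dualChange t) t := by
  refine (((hasDerivAt_change t).fun_pow 2).const_mul (1 / 2)).congr_deriv ?_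
  rw [deriv_change]
  ring

theorem abs_change_mul_deriv_le (t : ℝ) : |dualChange t * deriv dualChange t| ≤ 1 := by
  rw [abs_mul, abs_of_pos (deriv_change_pos t)]
  exact abs_change_mul_deriv_le_one t

/-- The derivative of `f²/2` is `f f'`, which is bounded by 1. This is the square-root growth of `f`
at infinity. -/
theorem change_sq_le_two_mul_abs (t : ℝ) : dualChange t ^ 2 ≤ 2 * |t| := by
  have h := Convex.norm_image_sub_le_of_norm_deriv_le (f := fun t => 1 / 2 * dualChange t ^ 2)
    (C := 1) (s := univ) (x := 0) (y := t)
    (fun x _ => (hasDerivAt_half_change_sq x).differentiableAt)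
    (fun x _ => by
      rw [(hasDerivAt_half_change_sq x).deriv]
      exact abs_change_mul_deriv_le x) convex_univ (mem_univ _) (mem_univ _)
  simp only [change_zero, Real.norm_eq_abs, sub_zero, one_mul] at h
  have := (abs_le.1 h).2
  norm_num at this
  linarith

/-- The derivative of `f f'` is `(1 + 2 f²)^(-2) ≤ 1`. -/
theorem abs_sub_change_mul_deriv_le (s t : ℝ) :
    |dualChange t * deriv dualChange t - dualChange s * deriv dualChange s| ≤ |t - s| := by
  have hd : ∀ t, HasDerivAt (fun t => dualChange t * (1 / √(1 + 2 * dualChange t ^ 2)))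
      (1 / (1 + 2 * dualChange t ^ 2) ^ 2) t := fun t => by
    have hp : (0 : ℝ) < 1 + 2 * dualChange t ^ 2 := by positivity
    have h1 : HasDerivAt (fun t : ℝ => 1 + 2 * dualChange t ^ 2)
        (4 * dualChange t * (1 / √(1 + 2 * dualChange t ^ 2))) t := by
      refine ((((hasDerivAt_change t).fun_pow 2).const_mul 2).const_add 1).congr_deriv ?_
      norm_num
      ring
    have h3 := (hasDerivAt_change t).div (h1.sqrt hp.ne') (integrand_pos _).ne'
    have hpos := integrand_pos (dualChange t)
    have hsq := Real.sq_sqrt hp.le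
    refine (h3.congr_deriv ?_).congr_of_eventuallyEq
      (Filter.Eventually.of_forall fun x => by simp [div_eq_mul_inv])
    set y := √(1 + 2 * dualChange t ^ 2)
    have hy4 : (1 + 2 * dualChange t ^ 2) ^ 2 = y ^ 4 := by rw [← hsq]; ring
    have hf2 : dualChange t ^ 2 = (y ^ 2 - 1) / 2 := by rw [hsq]; ring
    rw [hy4]
    field_simp
    rw [hf2]
    ring
  have h := Convex.norm_image_sub_le_of_norm_deriv_le
    (f := fun t => dualChange t * (1 / √(1 + 2 * dualChange t ^ 2)))
    (C := 1) (s := univ) (x := s) (y := t) (fun x _ => (hd x).differentiableAt)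
    (fun x _ => by
      rw [(hd x).deriv, Real.norm_eq_abs, abs_of_nonneg (by positivity),
        div_le_one (by positivity)]
      exact one_le_pow₀ (by nlinarith [sq_nonneg (dualChange x)])) convex_univ (mem_univ _)
    (mem_univ _)
  simpa [deriv_change] using h

/-- On bounded sets, `t²` is controlled by `f(t)²`. -/
theorem exists_sq_le_mul_change_sq (M : ℝ) :
    ∃ C > 0, ∀ t, |t| ≤ M → t ^ 2 ≤ C * dualChange t ^ 2 := by
  set m := max M 1
  have hm : 0 < m := lt_max_of_lt_right one_pos
  have hmono : StrictMono dualChange := strictMono_of_deriv_pos deriv_change_pos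
  have hfm : 0 < dualChange m := by simpa [change_zero] using hmono hm
  refine ⟨(m / dualChange m) ^ 2, by positivity, fun t ht => ?_⟩
  rw [← change_sq_abs, ← sq_abs t, ← mul_pow]
  rcases (abs_nonneg t).eq_or_lt with h0 | h0
  · rw [← h0, change_zero]
    simp
  have htm : |t| ≤ m := ht.trans (le_max_left _ _)
  -- The ratio `f(t)/t` is nonincreasing on the positive half-line, so its smallest value on `(0,
  -- m]` is the one at `m`.
  have h := change_mul_le (k := m / |t|) (t := |t|) ((one_le_div h0).2 htm) h0.le
  rw [div_mul_cancel₀ _ h0.ne', div_mul_eq_mul_div, le_div_iff₀ h0] at h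
  have : |t| ≤ m / dualChange m * dualChange |t| := by
    rw [div_mul_eq_mul_div, le_div_iff₀ hfm]
    linarith
  gcongr

/-! ### The pointwise decay of radial functions -/

/-- A one-dimensional decay estimate with the weight `s ^ (N - 1)`. -/
theorem abs_le_rpow_mul_weighted_integral {N : ℕ} (hN : 3 ≤ N) {ψ : ℝ → ℝ} (hψ : ContDiff ℝ 1 ψ)
    (hψc : HasCompactSupport ψ) {r : ℝ} (hr : 0 < r) :
    |ψ r| ≤ r ^ (-(((N : ℝ) - 2) / 2)) * (1 + ∫ s in Ioi 0, s ^ (N - 1) * deriv ψ s ^ 2) := by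
  have h3 : (3 : ℝ) ≤ N := by exact_mod_cast hN
  set κ := ((N : ℝ) - 2) / 2 with hκ
  -- `l` is the weight in the AM-GM inequality below, chosen because `∫_r^∞ s^(1-N) ds =
  -- r^(2-N)/(N-2) = l²/(N-2)`: the term carrying `l⁻¹` is then at most a multiple of `l`.
  set l := r ^ (-κ) with hl
  have hl0 : 0 < l := Real.rpow_pos_of_pos hr _
  have hdc : Continuous (deriv ψ) := hψ.continuous_deriv le_rfl
  have hdi : Integrable fun s => s ^ (N - 1) * deriv ψ s ^ 2 := by
    refine Continuous.integrable_of_hasCompactSupport (by fun_prop) ?_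
    exact (hψc.deriv.comp_left (g := fun x : ℝ => x ^ 2) (by simp)).mul_left
  have hlt : (1 : ℝ) - N < -1 := by linarith
  have hpi : IntegrableOn (fun s : ℝ => s ^ ((1 : ℝ) - N)) (Ioi r) :=
    integrableOn_Ioi_rpow_of_lt hlt hr
  have h1 : |ψ r| ≤ ∫ s in Ioi r, |deriv ψ s| := by
    rw [← abs_neg, ← hψc.integral_Ioi_deriv_eq hψ r]
    exact abs_integral_le_integral_abs
  have h2 : ∫ s in Ioi r, |deriv ψ s| ≤
      ∫ s in Ioi r, (1 / 2 * l * (s ^ (N - 1) * deriv ψ s ^ 2) +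
        1 / 2 * l⁻¹ * s ^ ((1 : ℝ) - N)) := by
    refine setIntegral_mono_on
      (hdc.integrable_of_hasCompactSupport hψc.deriv).abs.integrableOn
      ((hdi.integrableOn.const_mul _).add (hpi.const_mul _)) measurableSet_Ioi fun s hs => ?_
    have hs0 : 0 < s := hr.trans hs
    have e : s ^ ((1 : ℝ) - N) = (s ^ (N - 1))⁻¹ := by
      rw [← Real.rpow_natCast, ← Real.rpow_neg hs0.le, Nat.cast_sub (by omega)]
      congr 1
      push_cast
      ring
    rw [e]
    set p := s ^ (N - 1)
    have hp : 0 < p := by positivity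
    rw [← sq_abs (deriv ψ s)]
    have hq : 0 < l * p := by positivity
    have key : |deriv ψ s| ≤ 1 / 2 * ((l * p) * |deriv ψ s| ^ 2 + (l * p)⁻¹) := by
      have := two_mul_le_add_sq (√(l * p) * |deriv ψ s|) (√(l * p))⁻¹
      rw [mul_pow, inv_pow, Real.sq_sqrt hq.le] at this
      have e2 : 2 * (√(l * p) * |deriv ψ s|) * (√(l * p))⁻¹ = 2 * |deriv ψ s| := by
        field_simp
      rw [e2] at this
      linarith
    refine key.trans (le_of_eq ?_)
    rw [mul_inv]
    ring
  have h3' : ∫ s in Ioi r, (1 / 2 * l * (s ^ (N - 1) * deriv ψ s ^ 2) +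
        1 / 2 * l⁻¹ * s ^ ((1 : ℝ) - N)) =
      1 / 2 * l * (∫ s in Ioi r, s ^ (N - 1) * deriv ψ s ^ 2) +
        1 / 2 * l⁻¹ * (-r ^ ((1 : ℝ) - N + 1) / ((1 : ℝ) - N + 1)) := by
    rw [integral_add (hdi.integrableOn.const_mul _) (hpi.const_mul _), integral_const_mul,
      integral_const_mul, integral_Ioi_rpow_of_lt hlt hr]
  have h4 : ∫ s in Ioi r, s ^ (N - 1) * deriv ψ s ^ 2 ≤
      ∫ s in Ioi 0, s ^ (N - 1) * deriv ψ s ^ 2 := by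
    refine setIntegral_mono_set hdi.integrableOn ?_ (Ioi_subset_Ioi hr.le).eventuallyLE
    filter_upwards [ae_restrict_mem measurableSet_Ioi] with s hs
    have : (0 : ℝ) < s := hs
    simp only [Pi.zero_apply]
    positivity
  have h5 : l⁻¹ * (-r ^ ((1 : ℝ) - N + 1) / ((1 : ℝ) - N + 1)) ≤ l := by
    have e : r ^ ((1 : ℝ) - N + 1) = l * l := by
      rw [hl, ← Real.rpow_add hr]
      congr 1
      rw [hκ]
      ring
    have e' : -(l * l) / ((1 : ℝ) - N + 1) = l * l / (N - 2) := by
      rw [neg_div, ← div_neg]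
      congr 1
      ring
    rw [e, e', inv_mul_le_iff₀ hl0]
    exact div_le_self (by positivity) (by linarith)
  have h6 : 0 ≤ ∫ s in Ioi (0 : ℝ), s ^ (N - 1) * deriv ψ s ^ 2 :=
    setIntegral_nonneg measurableSet_Ioi fun s hs => by
      have : (0 : ℝ) < s := hs
      positivity
  rw [h3'] at h2
  have h7 := mul_le_mul_of_nonneg_left h4 hl0.le
  have h8 := mul_nonneg hl0.le h6
  nlinarith

/-- The profile is `ψ(s) = φ(s e)` for a unit vector `e`. Its derivative at `‖x‖` is the derivative
of `φ` at `x` in the direction `x/‖x‖`, hence at most `‖∇φ(x)‖`; polar coordinates do the rest. -/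
theorem integral_weighted_radial_deriv_le {N : ℕ} [hN : Fact (3 ≤ N)]
    {φ : EuclideanSpace ℝ (Fin N) → ℝ} (hφ : φ ∈ radialTestFunctions N) :
    ∃ ψ : ℝ → ℝ, ContDiff ℝ 1 ψ ∧ HasCompactSupport ψ ∧ (∀ x, φ x = ψ ‖x‖) ∧
      N * (volume.real (Metric.ball (0 : EuclideanSpace ℝ (Fin N)) 1) *
        ∫ s in Ioi 0, s ^ (N - 1) * deriv ψ s ^ 2) ≤ ∫ x, ‖∇ φ x‖ ^ 2 := by
  obtain ⟨h1, h2, h3⟩ := hφ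
  have hN3 := hN.out
  let i : Fin N := ⟨0, by omega⟩
  have : Nontrivial (EuclideanSpace ℝ (Fin N)) :=
    Module.nontrivial_of_finrank_pos (R := ℝ) (by rw [finrank_euclideanSpace_fin]; omega)
  set e : EuclideanSpace ℝ (Fin N) := EuclideanSpace.single i 1 with he
  have hen : ‖e‖ = 1 := by simp [he]
  have hdiff : Differentiable ℝ φ := h1.differentiable (by simp)
  have hcomp : ∀ v : EuclideanSpace ℝ (Fin N), ‖v‖ = 1 → ∀ s : ℝ, φ (s • v) = φ (s • e) :=
    fun v hv s => h3 _ _ (by rw [norm_smul, norm_smul, hv, hen])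
  have hd : ∀ v : EuclideanSpace ℝ (Fin N), ∀ s : ℝ,
      HasDerivAt (fun s : ℝ => φ (s • v)) (fderiv ℝ φ (s • v) v) s := fun v s => by
    have := (hdiff (s • v)).hasFDerivAt.comp_hasDerivAt s ((hasDerivAt_id s).smul_const v)
    simpa [Function.comp_def] using this
  have hψd : ContDiff ℝ 1 fun s : ℝ => φ (s • e) :=
    (h1.of_le (by simp)).comp (contDiff_id.smul contDiff_const)
  refine ⟨fun s => φ (s • e), hψd, ?_, fun x => h3 _ _ ?_, ?_⟩
  · have hiso : Isometry fun s : ℝ => s • e := Isometry.of_dist_eq fun s t => by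
      rw [dist_eq_norm, ← sub_smul, norm_smul, hen, mul_one, dist_eq_norm]
    exact h2.comp_isClosedEmbedding hiso.isClosedEmbedding
  · rw [norm_smul, hen, mul_one, norm_norm]
  · have hI := integral_fun_norm_addHaar
      (volume : Measure (EuclideanSpace ℝ (Fin N))) fun s => deriv (fun s => φ (s • e)) s ^ 2
    rw [finrank_euclideanSpace_fin] at hI
    simp only [smul_eq_mul, nsmul_eq_mul] at hI
    rw [← hI]
    have hgc : Continuous fun x => ‖∇ φ x‖ ^ 2 := by
      have : ∀ x, ‖∇ φ x‖ = ‖fderiv ℝ φ x‖ := fun x => by simp [gradient]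
      simp only [this]
      exact (h1.continuous_fderiv (by simp)).norm.pow 2
    have hgs : HasCompactSupport fun x => ‖∇ φ x‖ ^ 2 := by
      have : (fun x => ‖∇ φ x‖ ^ 2) = (fun L => ‖L‖ ^ 2) ∘ fderiv ℝ φ := by
        funext x
        simp [gradient]
      rw [this]
      exact (h2.fderiv ℝ).comp_left (by simp)
    refine integral_mono_of_nonneg (Eventually.of_forall fun x => sq_nonneg _)
      (hgc.integrable_of_hasCompactSupport hgs) ?_
    have hne : ∀ᵐ x : EuclideanSpace ℝ (Fin N), x ≠ 0 := by
      simp [ae_iff]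
    filter_upwards [hne] with x hx
    have hx0 : 0 < ‖x‖ := norm_pos_iff.2 hx
    set v := ‖x‖⁻¹ • x with hv
    have hvn : ‖v‖ = 1 := by
      rw [hv, norm_smul, norm_inv, norm_norm, inv_mul_cancel₀ hx0.ne']
    have hxv : ‖x‖ • v = x := by rw [hv, smul_inv_smul₀ hx0.ne']
    have hdv : deriv (fun s => φ (s • e)) ‖x‖ = fderiv ℝ φ x v := by
      have h := hd v ‖x‖
      rw [hxv] at h
      rw [← h.deriv]
      congr 1
      funext s
      exact (hcomp v hvn s).symm
    rw [hdv, ← sq_abs]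
    have h := (fderiv ℝ φ x).le_opNorm v
    rw [hvn, mul_one, Real.norm_eq_abs] at h
    have hg : ‖∇ φ x‖ = ‖fderiv ℝ φ x‖ := by simp [gradient]
    rw [hg]
    gcongr

theorem norm_sq_eq_integral {N : ℕ}
    (F : Lp (EuclideanSpace ℝ (Fin N)) 2 (volume : Measure (EuclideanSpace ℝ (Fin N)))) :
    ‖F‖ ^ 2 = ∫ x, ‖F x‖ ^ 2 := by
  rw [← real_inner_self_eq_norm_sq, L2.inner_def]
  simp only [real_inner_self_eq_norm_sq]

/-- The one-dimensional estimate for test functions passes to the closure: convergence in `L^{2*}`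
gives an a.e. convergent subsequence, and the right side converges with the gradients. The bound is
not yet homogeneous in `w`. -/
theorem exists_abs_le_rpow_mul_one_add_sq (N : ℕ) [hN : Fact (3 ≤ N)] :
    ∃ c : ℝ, ∀ w ∈ D12r N,
      ∀ᵐ x, |w.1 x| ≤ ‖x‖ ^ (-(((N : ℝ) - 2) / 2)) * (1 + c * ‖w.2‖ ^ 2) := by
  have h3 : (3 : ℝ) ≤ N := by exact_mod_cast hN.out
  set b := volume.real (Metric.ball (0 : EuclideanSpace ℝ (Fin N)) 1) with hb
  have hb0 : 0 < b := by
    rw [hb, measureReal_def]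
    exact ENNReal.toReal_pos (Metric.measure_ball_pos _ _ one_pos).ne' measure_ball_lt_top.ne
  have hne : ∀ᵐ x : EuclideanSpace ℝ (Fin N), x ≠ 0 := by
    have : Nonempty (Fin N) := ⟨⟨0, by have := hN.out; omega⟩⟩
    have : Nontrivial (EuclideanSpace ℝ (Fin N)) :=
      Module.nontrivial_of_finrank_pos (R := ℝ) (by
        rw [finrank_euclideanSpace_fin]
        have := hN.out
        omega)
    simp [ae_iff]
  refine ⟨(N * b)⁻¹, fun w hw => ?_⟩
  obtain ⟨z, hz, hlim⟩ := mem_closure_iff_seq_limit.1 hw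
  have hz' : ∀ n, ∀ᵐ x, |(z n).1 x| ≤
      ‖x‖ ^ (-(((N : ℝ) - 2) / 2)) * (1 + (N * b)⁻¹ * ‖(z n).2‖ ^ 2) := fun n => by
    obtain ⟨φ, hφ, e1, e2⟩ := hz n
    obtain ⟨ψ, p1, p2, p3, p4⟩ := integral_weighted_radial_deriv_le hφ
    have e3 : ‖(z n).2‖ ^ 2 = ∫ x, ‖∇ φ x‖ ^ 2 := by
      rw [norm_sq_eq_integral]
      refine integral_congr_ae ?_
      filter_upwards [e2] with x hx
      rw [hx]
    filter_upwards [e1, hne] with x hx hx0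
    rw [hx, p3]
    refine (abs_le_rpow_mul_weighted_integral hN.out p1 p2 (norm_pos_iff.2 hx0)).trans ?_
    gcongr
    rw [e3, le_inv_mul_iff₀ (by positivity), mul_assoc]
    exact p4
  have hm := tendstoInMeasure_of_tendsto_Lp ((continuous_fst.tendsto w).comp hlim)
  obtain ⟨ns, hns, hae⟩ := hm.exists_seq_tendsto_ae
  filter_upwards [hae, ae_all_iff.2 hz'] with x hx hx'
  have hl2 : Tendsto (fun k => ‖x‖ ^ (-(((N : ℝ) - 2) / 2)) *
      (1 + (N * b)⁻¹ * ‖(z (ns k)).2‖ ^ 2)) atTop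
      (𝓝 (‖x‖ ^ (-(((N : ℝ) - 2) / 2)) * (1 + (N * b)⁻¹ * ‖w.2‖ ^ 2))) := by
    have h2 := ((continuous_snd.tendsto w).comp hlim).comp hns.tendsto_atTop
    exact (((h2.norm.pow 2).const_mul _).const_add 1).const_mul _
  exact le_of_tendsto_of_tendsto' hx.abs hl2 fun k => hx' (ns k)

/-- Decay of the functions in `D_r^{1,2}`: `|u(x)| ≤ C ‖∇u‖ |x|^{-(N-2)/2}`. -/
theorem exists_abs_le_mul_rpow (N : ℕ) [hN : Fact (3 ≤ N)] :
    ∃ c > 0, ∀ w ∈ D12r N, ∀ᵐ x, |w.1 x| ≤ c * ‖w.2‖ * ‖x‖ ^ (-(((N : ℝ) - 2) / 2)) := by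
  obtain ⟨c, hc⟩ := exists_abs_le_rpow_mul_one_add_sq N
  refine ⟨1 + |c|, by positivity, fun w hw => ?_⟩
  rcases eq_or_ne w.2 0 with h0 | h0
  · obtain ⟨C, hC⟩ := D12r_norm_le N
    have h := hC w hw
    rw [h0, norm_zero, mul_zero] at h
    have h := norm_le_zero_iff.1 h
    rw [h, h0]
    filter_upwards [Lp.coeFn_zero ℝ (sobolevExponent N)
      (volume : Measure (EuclideanSpace ℝ (Fin N)))] with x hx
    rw [hx]
    simp
  · have hn : 0 < ‖w.2‖ := norm_pos_iff.2 h0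
    -- Normalizing the gradient to norm 1 turns the inhomogeneous bound into a linear one.
    have h := hc (‖w.2‖⁻¹ • w) ((D12r N).smul_mem _ hw)
    filter_upwards [h, Lp.coeFn_smul ‖w.2‖⁻¹ w.1] with x hx hx'
    have e1 : (‖w.2‖⁻¹ • w).1 x = ‖w.2‖⁻¹ * w.1 x := hx'
    have e2 : ‖(‖w.2‖⁻¹ • w).2‖ = 1 := by
      rw [Prod.smul_snd, norm_smul, norm_inv, norm_norm, inv_mul_cancel₀ hn.ne']
    rw [e1, e2, abs_mul, abs_inv, abs_norm, inv_mul_le_iff₀ hn, one_pow, mul_one] at hx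
    refine hx.trans ?_
    have hr : 0 ≤ ‖x‖ ^ (-(((N : ℝ) - 2) / 2)) := by positivity
    calc _ ≤ ‖w.2‖ * (‖x‖ ^ (-(((N : ℝ) - 2) / 2)) * (1 + |c|)) := by
          gcongr
          exact le_abs_self c
      _ = _ := by ring

/-! ### An integrable radial weight -/

/-- `min (r^(τ-N)) (r^(-τ-N))`: integrable on `ℝ^N` as a function of `r = |x|` when `τ > 0`. -/
noncomputable def radialWeight (N : ℕ) (τ r : ℝ) : ℝ := min (r ^ (τ - N)) (r ^ (-τ - N))

theorem radialWeight_pos (N : ℕ) (τ : ℝ) {r : ℝ} (hr : 0 < r) : 0 < radialWeight N τ r :=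
  lt_min (Real.rpow_pos_of_pos hr _) (Real.rpow_pos_of_pos hr _)

theorem radialWeight_nonneg (N : ℕ) (τ : ℝ) {r : ℝ} (hr : 0 ≤ r) : 0 ≤ radialWeight N τ r :=
  le_min (Real.rpow_nonneg hr _) (Real.rpow_nonneg hr _)

theorem continuousOn_radialWeight (N : ℕ) (τ : ℝ) : ContinuousOn (radialWeight N τ) (Ioi 0) :=
  (continuousOn_id.rpow_const fun _ hr => Or.inl (ne_of_gt hr)).inf
    (continuousOn_id.rpow_const fun _ hr => Or.inl (ne_of_gt hr))

theorem radialWeight_of_le_one {N : ℕ} {τ r : ℝ} (hτ : 0 ≤ τ) (hr : 0 < r) (hr1 : r ≤ 1) :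
    radialWeight N τ r = r ^ (τ - N) :=
  min_eq_left (Real.rpow_le_rpow_of_exponent_ge hr hr1 (by linarith))

theorem radialWeight_of_one_le {N : ℕ} {τ r : ℝ} (hτ : 0 ≤ τ) (hr1 : 1 ≤ r) :
    radialWeight N τ r = r ^ (-τ - N) :=
  min_eq_right (Real.rpow_le_rpow_of_exponent_le hr1 (by linarith))

/-- In polar coordinates the integrand becomes `r^(τ-1)` on `(0, 1]` and `r^(-τ-1)` beyond 1. -/
theorem integrable_radialWeight {N : ℕ} (hN : 1 ≤ N) {τ : ℝ} (hτ : 0 < τ) :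
    Integrable (fun x : EuclideanSpace ℝ (Fin N) => radialWeight N τ ‖x‖) := by
  have : Nontrivial (EuclideanSpace ℝ (Fin N)) :=
    Module.nontrivial_of_finrank_pos (R := ℝ) (by rw [finrank_euclideanSpace_fin]; omega)
  have hmul : ∀ y : ℝ, 0 < y → ∀ e : ℝ, y ^ (N - 1) * y ^ (e - N) = y ^ (e - 1) := by
    intro y hy e
    rw [← Real.rpow_natCast, ← Real.rpow_add hy, Nat.cast_sub hN]
    congr 1
    push_cast
    ring
  have hm : ∀ s, AEStronglyMeasurable (fun y : ℝ => y ^ (N - 1) • radialWeight N τ y)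
      (volume.restrict s) := fun s => by
    have : Measurable (radialWeight N τ) :=
      (measurable_id.pow_const _).min (measurable_id.pow_const _)
    exact ((measurable_id.pow_const _).smul this).aestronglyMeasurable
  rw [integrable_fun_norm_addHaar (volume : Measure (EuclideanSpace ℝ (Fin N)))
    (f := radialWeight N τ), finrank_euclideanSpace_fin, ← Ioc_union_Ioi_eq_Ioi zero_le_one]
  refine IntegrableOn.union ?_ ?_
  · have hi : IntegrableOn (fun y : ℝ => y ^ (τ - 1)) (Ioc 0 1) :=
      (intervalIntegrable_iff_integrableOn_Ioc_of_le zero_le_one).1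
        (intervalIntegral.intervalIntegrable_rpow' (by linarith))
    refine Integrable.mono' hi (hm _) ?_
    filter_upwards [ae_restrict_mem measurableSet_Ioc] with y hy
    have hy0 : 0 < y := hy.1
    rw [radialWeight_of_le_one hτ.le hy0 hy.2, smul_eq_mul, hmul y hy0, Real.norm_of_nonneg]
    positivity
  · have hi : IntegrableOn (fun y : ℝ => y ^ (-τ - 1)) (Ioi 1) :=
      integrableOn_Ioi_rpow_of_lt (by linarith) one_pos
    refine Integrable.mono' hi (hm _) ?_
    filter_upwards [ae_restrict_mem measurableSet_Ioi] with y hy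
    have hy1 : 1 < y := hy
    have hy0 : 0 < y := one_pos.trans hy1
    rw [radialWeight_of_one_le hτ.le hy1.le, smul_eq_mul, hmul y hy0, Real.norm_of_nonneg]
    positivity

/-! ### Norm and modular -/

theorem ae_norm_pos (N : ℕ) [hN : Fact (3 ≤ N)] :
    ∀ᵐ x : EuclideanSpace ℝ (Fin N), 0 < ‖x‖ := by
  have : Nontrivial (EuclideanSpace ℝ (Fin N)) :=
    Module.nontrivial_of_finrank_pos (R := ℝ) (by
      rw [finrank_euclideanSpace_fin]
      have := hN.out
      omega)
  simp [ae_iff]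

/-- The coefficients are controlled only away from the origin, which is a null set. -/
theorem aestronglyMeasurable_comp_norm (N : ℕ) [Fact (3 ≤ N)] {W : ℝ → ℝ}
    (hW : ContinuousOn W (Ioi 0)) :
    AEStronglyMeasurable (fun x : EuclideanSpace ℝ (Fin N) => W ‖x‖) volume := by
  have h : ContinuousOn (fun x : EuclideanSpace ℝ (Fin N) => W ‖x‖) {x | 0 < ‖x‖} :=
    hW.comp continuous_norm.continuousOn fun x hx => hx
  have hms : MeasurableSet {x : EuclideanSpace ℝ (Fin N) | 0 < ‖x‖} :=
    measurableSet_lt measurable_const measurable_norm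
  have h2 := h.aestronglyMeasurable (μ := volume) hms
  have hr : volume.restrict {x : EuclideanSpace ℝ (Fin N) | 0 < ‖x‖} = volume :=
    Measure.restrict_eq_self_of_ae_mem (ae_norm_pos N)
  rwa [hr] at h2

namespace OrliczSobolev

variable {N : ℕ} [hN : Fact (3 ≤ N)] {V : ℝ → ℝ}

theorem gradNorm_le_norm (u : OrliczSobolev N V) : u.gradNorm ≤ ‖u‖ := by
  rw [norm_def]
  linarith [u.orliczNorm_nonneg]

theorem orliczNorm_le_norm (u : OrliczSobolev N V) : u.orliczNorm ≤ ‖u‖ := by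
  have : 0 ≤ u.gradNorm := Real.sqrt_nonneg _
  rw [norm_def]
  linarith

theorem aestronglyMeasurable_fn (u : OrliczSobolev N V) : AEStronglyMeasurable u.fn volume :=
  Lp.aestronglyMeasurable u.1.1.1

/-- If the modular exceeded `‖u‖`, some `k` would make the Amemiya quantity smaller than both 1 and
the modular. Being below 1 forces `k ≥ 1`, and then convexity of `f²` with `f(0) = 0` gives `f(u)² ≤
f(ku)²/k`, a contradiction. -/
theorem integral_change_sq_le_norm (u : OrliczSobolev N V) (hu : ‖u‖ < 1) :
    ∫ x, dualChange (u.fn x) ^ 2 ∂radialMeasure N V ≤ ‖u‖ := by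
  by_contra! hlt
  have h : u.orliczNorm < min 1 (∫ x, dualChange (u.fn x) ^ 2 ∂radialMeasure N V) :=
    (orliczNorm_le_norm u).trans_lt (lt_min hu hlt)
  have : Nonempty (Ioi (0 : ℝ)) := ⟨⟨1, mem_Ioi.2 one_pos⟩⟩
  obtain ⟨⟨k, hk⟩, hk'⟩ := exists_lt_of_ciInf_lt h
  have hk : 0 < k := hk
  have hI : 0 ≤ ∫ x, dualChange (k * u.fn x) ^ 2 ∂radialMeasure N V :=
    integral_nonneg fun x => sq_nonneg _
  obtain ⟨h1, h2⟩ := lt_min_iff.1 hk'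
  simp only [amemiya] at h1 h2
  rw [div_mul_eq_mul_div, one_mul] at h1 h2
  rw [div_lt_one hk] at h1
  have hk1 : 1 ≤ k := by linarith
  have hmono : ∫ x, dualChange (u.fn x) ^ 2 ∂radialMeasure N V ≤
      ∫ x, 1 / k * dualChange (k * u.fn x) ^ 2 ∂radialMeasure N V := by
    refine integral_mono (integrable_change_sq u)
      ((integrable_change_mul_sq u k).const_mul _) fun x => ?_
    have h := convexOn_change_sq.2 (mem_univ (k * u.fn x)) (mem_univ 0)
      (by positivity : 0 ≤ 1 / k) (by rw [sub_nonneg, div_le_one hk]; exact hk1 : 0 ≤ 1 - 1 / k)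
      (by ring)
    simp only [smul_eq_mul, mul_zero, add_zero, change_zero] at h
    have e : 1 / k * (k * u.fn x) = u.fn x := by field_simp
    rw [e] at h
    simpa using h
  rw [integral_const_mul] at hmono
  have : 1 / k * ∫ x, dualChange (k * u.fn x) ^ 2 ∂radialMeasure N V ≤
      (1 + ∫ x, dualChange (k * u.fn x) ^ 2 ∂radialMeasure N V) / k := by
    rw [div_mul_eq_mul_div, one_mul]
    gcongr
    linarith
  linarith

theorem integrable_mul_change_sq (hVc : ContinuousOn V (Ioi 0)) (hV0 : ∀ r > 0, 0 ≤ V r)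
    (u : OrliczSobolev N V) :
    Integrable (fun x => V ‖x‖ * dualChange (u.fn x) ^ 2) := by
  have h := integrable_change_sq u
  have hm := (aestronglyMeasurable_comp_norm N hVc).aemeasurable.ennreal_ofReal
  rw [radialMeasure, integrable_withDensity_iff_integrable_smul₀' hm
    (Eventually.of_forall fun x => ENNReal.ofReal_lt_top)] at h
  refine h.congr ?_
  filter_upwards [ae_norm_pos N] with x hx
  rw [ENNReal.toReal_ofReal (hV0 _ hx), smul_eq_mul]

theorem integral_mul_change_sq (hVc : ContinuousOn V (Ioi 0)) (hV0 : ∀ r > 0, 0 ≤ V r)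
    (u : OrliczSobolev N V) :
    ∫ x, V ‖x‖ * dualChange (u.fn x) ^ 2 = ∫ x, dualChange (u.fn x) ^ 2 ∂radialMeasure N V := by
  have hm := (aestronglyMeasurable_comp_norm N hVc).aemeasurable.ennreal_ofReal
  rw [radialMeasure, integral_withDensity_eq_integral_toReal_smul₀ hm
    (Eventually.of_forall fun x => ENNReal.ofReal_lt_top)]
  refine integral_congr_ae ?_
  filter_upwards [ae_norm_pos N] with x hx
  rw [ENNReal.toReal_ofReal (hV0 _ hx), smul_eq_mul]

theorem integral_mul_change_sq_le (hVc : ContinuousOn V (Ioi 0)) (hV0 : ∀ r > 0, 0 ≤ V r)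
    (u : OrliczSobolev N V) (hu : ‖u‖ < 1) :
    ∫ x, V ‖x‖ * dualChange (u.fn x) ^ 2 ≤ ‖u‖ := by
  rw [integral_mul_change_sq hVc hV0]
  exact integral_change_sq_le_norm u hu

theorem exists_abs_fn_le (N : ℕ) [hN : Fact (3 ≤ N)] (V : ℝ → ℝ) :
    ∃ c > 0, ∀ u : OrliczSobolev N V,
      ∀ᵐ x, |u.fn x| ≤ c * ‖u‖ * ‖x‖ ^ (-(((N : ℝ) - 2) / 2)) := by
  obtain ⟨c, hc, h⟩ := exists_abs_le_mul_rpow N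
  refine ⟨c, hc, fun u => ?_⟩
  filter_upwards [h u.1.1 u.1.2] with x hx
  have hg := gradNorm_le_norm u
  rw [gradNorm_eq] at hg
  refine hx.trans ?_
  gcongr

end OrliczSobolev

/-! ### Differentiability of integral functionals -/

/-- A radial coefficient `W` and a nonlinearity `φ` with primitive `Φ`, with the estimates that
make `u ↦ ∫ W(|x|) Φ(u) dx` continuously differentiable on the Orlicz-Sobolev space. -/
structure AdmissibleIntegrand (N : ℕ) (V : ℝ → ℝ) (τ : ℝ) (W φ Φ : ℝ → ℝ) : Prop where
  continuousOn : ContinuousOn W (Ioi 0)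
  nonneg : ∀ r > 0, 0 ≤ W r
  continuous : Continuous φ
  hasDerivAt : ∀ t, HasDerivAt Φ (φ t) t
  primitive_zero : Φ 0 = 0
  bound : ∀ M > 0, ∃ C, 0 ≤ C ∧ ∀ r > 0, ∀ a b : ℝ, |a| ≤ M * r ^ (-(((N : ℝ) - 2) / 2)) →
    |b| ≤ M * r ^ (-(((N : ℝ) - 2) / 2)) →
    W r * (|φ a| * |b|) ≤
      C * (radialWeight N τ r + V r * (dualChange a ^ 2 + dualChange b ^ 2))
  bound_sub : ∀ M > 0, ∀ η > 0, ∃ ρ > 0, ∃ D, 0 ≤ D ∧ ∀ r > 0, ∀ a b s : ℝ,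
    |a| ≤ M * r ^ (-(((N : ℝ) - 2) / 2)) → |b| ≤ M * r ^ (-(((N : ℝ) - 2) / 2)) →
    |s| ≤ ρ * r ^ (-(((N : ℝ) - 2) / 2)) →
    W r * (|φ (a + s) - φ a| * |b|) ≤
      η * (radialWeight N τ r + V r * (dualChange a ^ 2 + dualChange b ^ 2)) +
        D * (V r * dualChange s ^ 2)

/-- Mean value theorem, with the intermediate point written as an offset `t`. The later bounds hold
for all offsets with `|t| ≤ |s|`, so no measurable choice of `t` in the variable `x` is needed. -/
theorem exists_mul_eq_sub_of_hasDerivAt {φ Φ : ℝ → ℝ} (h : ∀ t, HasDerivAt Φ (φ t) t) (a s : ℝ) :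
    ∃ t, |t| ≤ |s| ∧ Φ (a + s) - Φ a = φ (a + t) * s := by
  have hd : ∀ t, HasDerivAt (fun t : ℝ => Φ (a + t * s)) (φ (a + t * s) * s) t := fun t =>
    (h (a + t * s)).comp t (by simpa using ((hasDerivAt_id t).mul_const s).const_add a)
  obtain ⟨t, ht, he⟩ := exists_hasDerivAt_eq_slope (fun t : ℝ => Φ (a + t * s))
    (fun t => φ (a + t * s) * s) (zero_lt_one (α := ℝ))
    (fun t _ => (hd t).continuousAt.continuousWithinAt) fun t _ => hd t
  refine ⟨t * s, ?_, ?_⟩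
  · rw [abs_mul, abs_of_pos ht.1]
    exact mul_le_of_le_one_left (abs_nonneg s) ht.2.le
  · rw [he]
    simp

/-- Homogeneity. The radius `1/2` keeps test vectors inside the open unit ball, where the modular is
bounded by the norm. -/
theorem abs_le_mul_norm_of_half_ball {E : Type*} [NormedAddCommGroup E] [NormedSpace ℝ E]
    (L : E →ₗ[ℝ] ℝ) {B : ℝ} (h : ∀ k, ‖k‖ ≤ 1 / 2 → |L k| ≤ B) (k : E) :
    |L k| ≤ 2 * B * ‖k‖ := by
  rcases eq_or_ne k 0 with rfl | hk
  · simp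
  have hn : 0 < ‖k‖ := norm_pos_iff.2 hk
  have h1 := h ((2 * ‖k‖)⁻¹ • k) (by
    rw [norm_smul, norm_inv, norm_mul, norm_norm]
    norm_num
    field_simp
    rfl)
  rw [map_smul, smul_eq_mul, abs_mul, abs_of_pos (by positivity : 0 < (2 * ‖k‖)⁻¹),
    inv_mul_le_iff₀ (by positivity)] at h1
  linarith

namespace AdmissibleIntegrand

open OrliczSobolev

variable {N : ℕ} [hN : Fact (3 ≤ N)] {V : ℝ → ℝ} {τ : ℝ} {W φ Φ : ℝ → ℝ}

/-- Letting `s` range over all `|s| ≤ |u(x)|` covers both `φ(u)` itself and the intermediate values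
of `φ` that appear when `Φ(u)` is estimated. The constant depends on `k` only through the bound `m`.
-/
theorem exists_dominating (h : AdmissibleIntegrand N V τ W φ Φ) (hV0 : ∀ r > 0, 0 ≤ V r)
    (u : OrliczSobolev N V) (m : ℝ) :
    ∃ C, 0 ≤ C ∧ ∀ k : OrliczSobolev N V, ‖k‖ ≤ m → ∀ᵐ x, ∀ s, |s| ≤ |u.fn x| →
      W ‖x‖ * (|φ s| * |k.fn x|) ≤ C * (radialWeight N τ ‖x‖ + (V ‖x‖ * dualChange (u.fn x) ^ 2 +
        V ‖x‖ * dualChange (k.fn x) ^ 2)) := by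
  obtain ⟨c, hc, hdec⟩ := exists_abs_fn_le N V
  set m' := max ‖u‖ (max m 1)
  have hm' : 0 < m' := lt_max_of_lt_right (lt_max_of_lt_right one_pos)
  obtain ⟨C, hC0, hC⟩ := h.bound (c * m') (by positivity)
  refine ⟨C, hC0, fun k hk => ?_⟩
  have hk' : ‖k‖ ≤ m' := hk.trans ((le_max_left _ _).trans (le_max_right _ _))
  filter_upwards [ae_norm_pos N, hdec u, hdec k] with x hx hu hkx s hs
  refine (hC ‖x‖ hx s (k.fn x) (hs.trans (hu.trans ?_)) (hkx.trans ?_)).trans ?_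
  · gcongr
    exact le_max_left _ _
  · gcongr
  · rw [← mul_add]
    have := hV0 _ hx
    have := change_sq_le hs
    gcongr

theorem integrable_dominating (hτ : 0 < τ) (hVc : ContinuousOn V (Ioi 0))
    (hV0 : ∀ r > 0, 0 ≤ V r) (u k : OrliczSobolev N V) (C : ℝ) :
    Integrable fun x => C * (radialWeight N τ ‖x‖ + (V ‖x‖ * dualChange (u.fn x) ^ 2 +
        V ‖x‖ * dualChange (k.fn x) ^ 2)) :=
  ((integrable_radialWeight (by have := hN.out; omega) hτ).add
    ((integrable_mul_change_sq hVc hV0 u).add (integrable_mul_change_sq hVc hV0 k))).const_mul C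

theorem integral_dominating (hτ : 0 < τ) (hVc : ContinuousOn V (Ioi 0))
    (hV0 : ∀ r > 0, 0 ≤ V r) (u k : OrliczSobolev N V) (C : ℝ) :
    ∫ x, C * (radialWeight N τ ‖x‖ + (V ‖x‖ * dualChange (u.fn x) ^ 2 +
        V ‖x‖ * dualChange (k.fn x) ^ 2)) =
      C * ((∫ x : EuclideanSpace ℝ (Fin N), radialWeight N τ ‖x‖) +
        ((∫ x, V ‖x‖ * dualChange (u.fn x) ^ 2) + ∫ x, V ‖x‖ * dualChange (k.fn x) ^ 2)) := by
  have h1 := integrable_mul_change_sq hVc hV0 u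
  have h2 := integrable_mul_change_sq hVc hV0 k
  have h3 : Integrable fun x =>
      V ‖x‖ * dualChange (u.fn x) ^ 2 + V ‖x‖ * dualChange (k.fn x) ^ 2 := h1.add h2
  rw [integral_const_mul,
    integral_add (integrable_radialWeight (by have := hN.out; omega) hτ) h3, integral_add h1 h2]

theorem aestronglyMeasurable_mul (h : AdmissibleIntegrand N V τ W φ Φ)
    (u k : OrliczSobolev N V) :
    AEStronglyMeasurable (fun x => W ‖x‖ * (φ (u.fn x) * k.fn x)) volume :=
  (aestronglyMeasurable_comp_norm N h.continuousOn).mul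
    ((h.continuous.comp_aestronglyMeasurable (aestronglyMeasurable_fn u)).mul
      (aestronglyMeasurable_fn k))

theorem integrable_mul (h : AdmissibleIntegrand N V τ W φ Φ) (hτ : 0 < τ)
    (hVc : ContinuousOn V (Ioi 0)) (hV0 : ∀ r > 0, 0 ≤ V r) (u k : OrliczSobolev N V) :
    Integrable fun x => W ‖x‖ * (φ (u.fn x) * k.fn x) := by
  obtain ⟨C, -, hC⟩ := h.exists_dominating hV0 u ‖k‖
  refine (integrable_dominating hτ hVc hV0 u k C).mono' (h.aestronglyMeasurable_mul u k) ?_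
  filter_upwards [hC k le_rfl, ae_norm_pos N] with x hx hx0
  rw [Real.norm_eq_abs, abs_mul, abs_mul, abs_of_nonneg (h.nonneg _ hx0)]
  exact hx _ le_rfl

theorem integrable_primitive (h : AdmissibleIntegrand N V τ W φ Φ) (hτ : 0 < τ)
    (hVc : ContinuousOn V (Ioi 0)) (hV0 : ∀ r > 0, 0 ≤ V r) (u : OrliczSobolev N V) :
    Integrable fun x => W ‖x‖ * Φ (u.fn x) := by
  obtain ⟨C, -, hC⟩ := h.exists_dominating hV0 u ‖u‖
  have hΦ : Continuous Φ := continuous_iff_continuousAt.2 fun t => (h.hasDerivAt t).continuousAt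
  refine (integrable_dominating hτ hVc hV0 u u C).mono'
    ((aestronglyMeasurable_comp_norm N h.continuousOn).mul
      (hΦ.comp_aestronglyMeasurable (aestronglyMeasurable_fn u))) ?_
  filter_upwards [hC u le_rfl, ae_norm_pos N] with x hx hx0
  -- Since `Φ(0) = 0`, one has `Φ(u) = φ(t) u` with `|t| ≤ |u|`: the dominating bound applies with
  -- `k = u`.
  obtain ⟨t, ht, he⟩ := exists_mul_eq_sub_of_hasDerivAt h.hasDerivAt 0 (u.fn x)
  rw [zero_add, zero_add, h.primitive_zero, sub_zero] at he
  rw [Real.norm_eq_abs, abs_mul, he, abs_mul, abs_of_nonneg (h.nonneg _ hx0)]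
  exact hx _ ht

/-- The differential of `u ↦ ∫ W(|x|) Φ(u) dx` at `u`, as a linear form. -/
noncomputable def linearForm (h : AdmissibleIntegrand N V τ W φ Φ) (hτ : 0 < τ)
    (hVc : ContinuousOn V (Ioi 0)) (hV0 : ∀ r > 0, 0 ≤ V r) (u : OrliczSobolev N V) :
    OrliczSobolev N V →ₗ[ℝ] ℝ where
  toFun k := ∫ x, W ‖x‖ * (φ (u.fn x) * k.fn x)
  map_add' k l := by
    rw [← integral_add (h.integrable_mul hτ hVc hV0 u k) (h.integrable_mul hτ hVc hV0 u l)]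
    refine integral_congr_ae ?_
    filter_upwards [fn_add k l] with x hx
    rw [hx, Pi.add_apply]
    ring
  map_smul' c k := by
    rw [RingHom.id_apply, smul_eq_mul, ← integral_const_mul]
    refine integral_congr_ae ?_
    filter_upwards [fn_smul c k] with x hx
    rw [hx, Pi.smul_apply, smul_eq_mul]
    ring

theorem exists_abs_linearForm_le (h : AdmissibleIntegrand N V τ W φ Φ) (hτ : 0 < τ)
    (hVc : ContinuousOn V (Ioi 0)) (hV0 : ∀ r > 0, 0 ≤ V r) (u : OrliczSobolev N V) :
    ∃ B, ∀ k, |h.linearForm hτ hVc hV0 u k| ≤ B * ‖k‖ := by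
  obtain ⟨C, hC0, hC⟩ := h.exists_dominating hV0 u (1 / 2)
  refine ⟨_, abs_le_mul_norm_of_half_ball _ (B := C *
    ((∫ x : EuclideanSpace ℝ (Fin N), radialWeight N τ ‖x‖) +
        ((∫ x, V ‖x‖ * dualChange (u.fn x) ^ 2) + 1))) fun k hk => ?_⟩
  have h1 : |h.linearForm hτ hVc hV0 u k| ≤ _ :=
    norm_integral_le_of_norm_le (f := fun x => W ‖x‖ * (φ (u.fn x) * k.fn x))
      (integrable_dominating hτ hVc hV0 u k C) (by
      filter_upwards [hC k hk, ae_norm_pos N] with x hx hx0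
      rw [Real.norm_eq_abs, abs_mul, abs_mul, abs_of_nonneg (h.nonneg _ hx0)]
      exact hx _ le_rfl)
  refine h1.trans ?_
  rw [integral_dominating hτ hVc hV0]
  have := integral_mul_change_sq_le hVc hV0 k (by linarith)
  gcongr
  linarith

/-- The differential of `u ↦ ∫ W(|x|) Φ(u) dx` at `u`. -/
noncomputable def differential (h : AdmissibleIntegrand N V τ W φ Φ) (hτ : 0 < τ)
    (hVc : ContinuousOn V (Ioi 0)) (hV0 : ∀ r > 0, 0 ≤ V r) (u : OrliczSobolev N V) :
    OrliczSobolev N V →L[ℝ] ℝ :=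
  (h.linearForm hτ hVc hV0 u).mkContinuousOfExistsBound
    (h.exists_abs_linearForm_le hτ hVc hV0 u)

theorem differential_apply (h : AdmissibleIntegrand N V τ W φ Φ) (hτ : 0 < τ)
    (hVc : ContinuousOn V (Ioi 0)) (hV0 : ∀ r > 0, 0 ≤ V r) (u k : OrliczSobolev N V) :
    h.differential hτ hVc hV0 u k = ∫ x, W ‖x‖ * (φ (u.fn x) * k.fn x) := rfl

/-- The oscillation of `φ` near `u` is small in the dual norm. -/
theorem exists_small_oscillation (h : AdmissibleIntegrand N V τ W φ Φ) (hτ : 0 < τ)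
    (hVc : ContinuousOn V (Ioi 0)) (hV0 : ∀ r > 0, 0 ≤ V r) (u : OrliczSobolev N V)
    {ε : ℝ} (hε : 0 < ε) :
    ∃ ρ > 0, ∀ v k : OrliczSobolev N V, ‖v‖ ≤ ρ → ‖k‖ ≤ 1 / 2 →
      ∃ B : EuclideanSpace ℝ (Fin N) → ℝ, Integrable B ∧ ∫ x, B x ≤ ε ∧
        ∀ᵐ x, ∀ s, |s| ≤ |v.fn x| →
          W ‖x‖ * (|φ (u.fn x + s) - φ (u.fn x)| * |k.fn x|) ≤ B x := by
  obtain ⟨c, hc, hdec⟩ := exists_abs_fn_le N V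
  set m := max ‖u‖ 1
  have hm : 0 < m := lt_max_of_lt_right one_pos
  set S := (∫ x : EuclideanSpace ℝ (Fin N), radialWeight N τ ‖x‖) +
        ((∫ x, V ‖x‖ * dualChange (u.fn x) ^ 2) + 1) with hS
  have hS0 : 0 < S := by
    have h1 : 0 ≤ ∫ x : EuclideanSpace ℝ (Fin N), radialWeight N τ ‖x‖ :=
      integral_nonneg fun x => radialWeight_nonneg _ _ (norm_nonneg x)
    have h2 : 0 ≤ ∫ x, V ‖x‖ * dualChange (u.fn x) ^ 2 := integral_nonneg_of_ae (by
      filter_upwards [ae_norm_pos N] with x hx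
      exact mul_nonneg (hV0 _ hx) (sq_nonneg _))
    rw [hS]
    linarith
  -- `S` bounds the integral multiplied by `η`, because the modular of `k` is at most 1; thus `η =
  -- ε/(2S)` costs `ε/2`.
  obtain ⟨ρ, hρ, D, hD0, hD⟩ := h.bound_sub (c * m) (by positivity) (ε / (2 * S)) (by positivity)
  -- In order: the decay estimate gives `|v(x)| ≤ ρ |x|^(-κ)`; the modular of `v` is at most `‖v‖`;
  -- and the `D` term integrates to at most `ε/2`, with `D + 1` guarding against `D = 0`.
  refine ⟨min (ρ / c) (min (1 / 2) (ε / (2 * (D + 1)))), by positivity, fun v k hv hk => ?_⟩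
  obtain ⟨hv1, hv2⟩ := le_min_iff.1 hv
  obtain ⟨hv2, hv3⟩ := le_min_iff.1 hv2
  have hi := integrable_dominating hτ hVc hV0 u k (ε / (2 * S))
  have hj := (integrable_mul_change_sq hVc hV0 v).const_mul D
  refine ⟨_, hi.add hj, ?_, ?_⟩
  · simp only [Pi.add_apply]
    rw [integral_add hi hj, integral_dominating hτ hVc hV0, integral_const_mul]
    have h1 := integral_mul_change_sq_le hVc hV0 k (by linarith)
    have h2 := integral_mul_change_sq_le hVc hV0 v (by linarith)
    have h3 : ε / (2 * S) * ((∫ x : EuclideanSpace ℝ (Fin N), radialWeight N τ ‖x‖) +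
        ((∫ x, V ‖x‖ * dualChange (u.fn x) ^ 2) + ∫ x, V ‖x‖ * dualChange (k.fn x) ^ 2)) ≤
        ε / (2 * S) * S := by
      gcongr
      linarith
    have h4 : ε / (2 * S) * S = ε / 2 := by field_simp
    have h5 : D * ∫ x, V ‖x‖ * dualChange (v.fn x) ^ 2 ≤ (D + 1) * (ε / (2 * (D + 1))) := by
      have : 0 ≤ ε / (2 * (D + 1)) := by positivity
      calc _ ≤ D * (ε / (2 * (D + 1))) := by
            gcongr
            linarith
        _ ≤ _ := by
            gcongr
            linarith
    have h6 : (D + 1) * (ε / (2 * (D + 1))) = ε / 2 := by field_simp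
    linarith
  · filter_upwards [ae_norm_pos N, hdec u, hdec k, hdec v] with x hx hu hkx hvx s hs
    refine (hD ‖x‖ hx (u.fn x) (k.fn x) s (hu.trans ?_) (hkx.trans ?_)
      (hs.trans (hvx.trans ?_))).trans ?_
    · gcongr
      exact le_max_left _ _
    · gcongr
      exact (hk.trans (by norm_num)).trans (le_max_right _ _)
    · gcongr
      rw [le_div_iff₀ hc] at hv1
      linarith
    · rw [Pi.add_apply, ← mul_add (V ‖x‖)]
      have := hV0 _ hx
      have := change_sq_le hs
      gcongr

theorem continuous_differential (h : AdmissibleIntegrand N V τ W φ Φ) (hτ : 0 < τ)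
    (hVc : ContinuousOn V (Ioi 0)) (hV0 : ∀ r > 0, 0 ≤ V r) :
    Continuous (h.differential hτ hVc hV0) := by
  refine Metric.continuous_iff.2 fun u ε hε => ?_
  -- Passing from the half ball to the operator norm doubles the bound, which leaves `ε/2 < ε`.
  obtain ⟨ρ, hρ, H⟩ := h.exists_small_oscillation hτ hVc hV0 u (ε := ε / 4) (by positivity)
  refine ⟨ρ, hρ, fun w hw => ?_⟩
  rw [dist_eq_norm] at hw ⊢
  refine lt_of_le_of_lt (ContinuousLinearMap.opNorm_le_bound _ (by positivity : 0 ≤ 2 * (ε / 4))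
    fun k => ?_) (by linarith : 2 * (ε / 4) < ε)
  refine abs_le_mul_norm_of_half_ball
    (h.differential hτ hVc hV0 w - h.differential hτ hVc hV0 u : OrliczSobolev N V →L[ℝ] ℝ).toLinearMap
    (fun k hk => ?_) k
  obtain ⟨B, hB, hBi, hBx⟩ := H (w - u) k hw.le hk
  have e : (h.differential hτ hVc hV0 w - h.differential hτ hVc hV0 u) k =
      ∫ x, W ‖x‖ * ((φ (w.fn x) - φ (u.fn x)) * k.fn x) := by
    rw [_root_.sub_apply, differential_apply, differential_apply,
      ← integral_sub (h.integrable_mul hτ hVc hV0 w k) (h.integrable_mul hτ hVc hV0 u k)]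
    congr 1
    funext x
    ring
  change |(h.differential hτ hVc hV0 w - h.differential hτ hVc hV0 u) k| ≤ _
  rw [e, ← Real.norm_eq_abs]
  refine (norm_integral_le_of_norm_le hB ?_).trans hBi
  have hw' := fn_add u (w - u)
  rw [add_sub_cancel] at hw'
  filter_upwards [hBx, ae_norm_pos N, hw'] with x hx hx0 hwx
  rw [Real.norm_eq_abs, abs_mul, abs_mul, abs_of_nonneg (h.nonneg _ hx0), hwx]
  exact hx _ le_rfl

theorem hasFDerivAt_integral (h : AdmissibleIntegrand N V τ W φ Φ) (hτ : 0 < τ)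
    (hVc : ContinuousOn V (Ioi 0)) (hV0 : ∀ r > 0, 0 ≤ V r) (u : OrliczSobolev N V) :
    HasFDerivAt (fun u : OrliczSobolev N V => ∫ x, W ‖x‖ * Φ (u.fn x))
      (h.differential hτ hVc hV0 u) u := by
  rw [hasFDerivAt_iff_isLittleO_nhds_zero, Asymptotics.isLittleO_iff]
  intro ε hε
  obtain ⟨ρ, hρ, H⟩ := h.exists_small_oscillation hτ hVc hV0 u (ε := ε / 2) (by positivity)
  filter_upwards [Metric.closedBall_mem_nhds 0 hρ] with v hv
  rw [mem_closedBall_zero_iff] at hv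
  rcases eq_or_ne v 0 with rfl | hv0
  · simp
  have hn : 0 < ‖v‖ := norm_pos_iff.2 hv0
  -- The test direction is `v` itself rescaled to norm `1/2`. Undoing the scaling supplies the
  -- factor `2 ‖v‖` that makes the remainder `o(‖v‖)`.
  obtain ⟨B, hB, hBi, hBx⟩ := H v ((2 * ‖v‖)⁻¹ • v) hv (by
    rw [norm_smul, norm_inv, norm_mul, norm_norm]
    norm_num
    field_simp
    rfl)
  have i1 := h.integrable_primitive hτ hVc hV0 (u + v)
  have i2 := h.integrable_primitive hτ hVc hV0 u
  have i3 := h.integrable_mul hτ hVc hV0 u v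
  have i4 : Integrable fun x => W ‖x‖ * Φ ((u + v).fn x) - W ‖x‖ * Φ (u.fn x) := i1.sub i2
  rw [differential_apply, ← integral_sub i1 i2, ← integral_sub i4 i3]
  refine (norm_integral_le_of_norm_le (hB.const_mul (2 * ‖v‖)) ?_).trans ?_
  · filter_upwards [hBx, ae_norm_pos N, fn_add u v, fn_smul (2 * ‖v‖)⁻¹ v] with x hx hx0 hux hvx
    rw [hux, Pi.add_apply, ← mul_sub, ← mul_sub]
    obtain ⟨t, ht, he⟩ := exists_mul_eq_sub_of_hasDerivAt h.hasDerivAt (u.fn x) (v.fn x)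
    have hx := hx t ht
    rw [hvx, Pi.smul_apply, smul_eq_mul, abs_mul,
      abs_of_pos (by positivity : 0 < (2 * ‖v‖)⁻¹)] at hx
    rw [he, ← sub_mul, Real.norm_eq_abs, abs_mul, abs_mul, abs_of_nonneg (h.nonneg _ hx0)]
    calc _ = 2 * ‖v‖ * (W ‖x‖ * (|φ (u.fn x + t) - φ (u.fn x)| * ((2 * ‖v‖)⁻¹ * |v.fn x|))) := by
          field_simp
      _ ≤ _ := by gcongr
  · rw [integral_const_mul]
    calc _ ≤ 2 * ‖v‖ * (ε / 2) := by gcongr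
      _ = _ := by ring

end AdmissibleIntegrand

/-! ### Pointwise estimates -/

theorem exists_mul_rpow_le {τ C η : ℝ} (hτ : 0 < τ) (hC : 0 ≤ C) (hη : 0 < η) :
    ∃ δ > 0, ∀ r > 0, r ≤ δ → C * r ^ τ ≤ η := by
  refine ⟨(η / (C + 1)) ^ τ⁻¹, by positivity, fun r hr hrδ => ?_⟩
  have h1 : r ^ τ ≤ η / (C + 1) := by
    calc r ^ τ ≤ ((η / (C + 1)) ^ τ⁻¹) ^ τ := by gcongr
      _ = η / (C + 1) := Real.rpow_inv_rpow (by positivity) hτ.ne'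
  rw [le_div_iff₀ (by positivity)] at h1
  have : 0 ≤ r ^ τ := by positivity
  linarith

theorem exists_mul_rpow_neg_le {τ C η : ℝ} (hτ : 0 < τ) (hC : 0 ≤ C) (hη : 0 < η) :
    ∃ L > 0, ∀ r ≥ L, C * r ^ (-τ) ≤ η := by
  obtain ⟨δ, hδ, h⟩ := exists_mul_rpow_le hτ hC hη
  refine ⟨δ⁻¹, by positivity, fun r hr => ?_⟩
  have hr0 : 0 < r := lt_of_lt_of_le (by positivity) hr
  have h1 := h r⁻¹ (by positivity) (inv_le_of_inv_le₀ hδ hr)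
  rwa [Real.inv_rpow hr0.le, ← Real.rpow_neg hr0.le] at h1

/-- On a compact annulus the quotient of `W` by the positive continuous weight is bounded. -/
theorem exists_le_mul_radialWeight {N : ℕ} {τ : ℝ} {W : ℝ → ℝ} (hW : ContinuousOn W (Ioi 0))
    {δ : ℝ} (hδ : 0 < δ) (L : ℝ) :
    ∃ C, 0 ≤ C ∧ ∀ r, δ ≤ r → r ≤ L → W r ≤ C * radialWeight N τ r := by
  have hsub : Icc δ L ⊆ Ioi 0 := fun r hr => hδ.trans_le hr.1
  have hc : ContinuousOn (fun r => W r / radialWeight N τ r) (Icc δ L) :=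
    (hW.mono hsub).div ((continuousOn_radialWeight N τ).mono hsub)
      fun r hr => (radialWeight_pos N τ (hsub hr)).ne'
  obtain ⟨C, hC⟩ := isCompact_Icc.bddAbove_image hc
  refine ⟨max C 0, le_max_right _ _, fun r h1 h2 => ?_⟩
  have h := hC (mem_image_of_mem _ ⟨h1, h2⟩)
  have h := h.trans (le_max_left C 0)
  rwa [div_le_iff₀ (radialWeight_pos N τ (hδ.trans_le h1))] at h

theorem mul_rpow_neg_le {M κ δ r : ℝ} (hM : 0 ≤ M) (hκ : 0 ≤ κ) (hδ : 0 < δ) (hr : δ ≤ r) :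
    M * r ^ (-κ) ≤ M * δ ^ (-κ) := by
  have := Real.rpow_le_rpow_of_nonpos hδ hr (neg_nonpos.2 hκ)
  gcongr

theorem rpow_neg_le_one {κ r : ℝ} (hκ : 0 ≤ κ) (hr : 1 ≤ r) : r ^ (-κ) ≤ 1 :=
  Real.rpow_le_one_of_one_le_of_nonpos hr (neg_nonpos.2 hκ)

/-- The estimates near the origin and near infinity yield an admissible integrand. -/
theorem AdmissibleIntegrand.of_tails {N : ℕ} [hN : Fact (3 ≤ N)] {V W φ Φ : ℝ → ℝ} {τ κ : ℝ}
    (hκ : κ = ((N : ℝ) - 2) / 2) (hτ : 0 < τ) (hV0 : ∀ r > 0, 0 ≤ V r)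
    (hW : ContinuousOn W (Ioi 0)) (hW0 : ∀ r > 0, 0 ≤ W r) (hφ : Continuous φ)
    (hΦ : ∀ t, HasDerivAt Φ (φ t) t) (hΦ0 : Φ 0 = 0) {δ₀ L₀ : ℝ} (hδ₀ : 0 < δ₀) (hδ₁ : δ₀ ≤ 1)
    (hL₀ : 1 ≤ L₀)
    (near : ∀ M > 0, ∃ C, 0 ≤ C ∧ ∀ r > 0, r < δ₀ → ∀ a b : ℝ, |a| ≤ M * r ^ (-κ) →
      |b| ≤ M * r ^ (-κ) → W r * (|φ a| * |b|) ≤ C * r ^ τ * radialWeight N τ r)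
    (far : ∀ M > 0, ∃ C, 0 ≤ C ∧ ∀ r > L₀, ∀ a b : ℝ, |a| ≤ M * r ^ (-κ) →
      |b| ≤ M * r ^ (-κ) → W r * (|φ a| * |b|) ≤ C * r ^ (-τ) *
        (radialWeight N τ r + V r * (dualChange a ^ 2 + dualChange b ^ 2))) :
    AdmissibleIntegrand N V τ W φ Φ := by
  have h3 : (3 : ℝ) ≤ N := by exact_mod_cast hN.out
  have hκ0 : 0 ≤ κ := by rw [hκ]; linarith
  refine ⟨hW, hW0, hφ, hΦ, hΦ0, fun M hM => ?_, fun M hM η hη => ?_⟩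
  · rw [← hκ]
    obtain ⟨C₁, hC₁, near⟩ := near M hM
    obtain ⟨C₂, hC₂, far⟩ := far M hM
    obtain ⟨C₃, hC₃, mid⟩ := exists_le_mul_radialWeight (N := N) (τ := τ) hW hδ₀ L₀
    -- Bound for the admissible values of `a` and `b` once `r ≥ δ₀`.
    set m := M * δ₀ ^ (-κ) with hm
    have hm0 : 0 < m := by positivity
    obtain ⟨c, hc⟩ := (isCompact_Icc (a := -m) (b := m)).exists_bound_of_continuousOn
      hφ.continuousOn
    refine ⟨C₁ + C₂ + C₃ * (|c| * m), by positivity, fun r hr a b ha hb => ?_⟩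
    have hP := radialWeight_nonneg N τ hr.le
    have hVf : 0 ≤ V r * (dualChange a ^ 2 + dualChange b ^ 2) :=
      mul_nonneg (hV0 r hr) (by positivity)
    have hcm : 0 ≤ C₃ * (|c| * m) := by positivity
    rcases lt_or_ge r δ₀ with h1 | h1
    · refine (near r hr h1 a b ha hb).trans ?_
      have : r ^ τ ≤ 1 := Real.rpow_le_one hr.le (by linarith) hτ.le
      calc _ ≤ C₁ * 1 * radialWeight N τ r := by gcongr
        _ ≤ (C₁ + C₂ + C₃ * (|c| * m)) *
            (radialWeight N τ r + V r * (dualChange a ^ 2 + dualChange b ^ 2)) := by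
          gcongr <;> linarith
    rcases le_or_gt r L₀ with h2 | h2
    · have ha' : |a| ≤ m := ha.trans (mul_rpow_neg_le hM.le hκ0 hδ₀ h1)
      have hb' : |b| ≤ m := hb.trans (mul_rpow_neg_le hM.le hκ0 hδ₀ h1)
      have hφa : |φ a| ≤ |c| := (hc a (abs_le.1 ha')).trans (le_abs_self c)
      have hw := mid r h1 h2
      have hw0 := hW0 r hr
      calc _ ≤ C₃ * radialWeight N τ r * (|c| * m) := by gcongr
        _ = C₃ * (|c| * m) * radialWeight N τ r := by ring
        _ ≤ (C₁ + C₂ + C₃ * (|c| * m)) *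
            (radialWeight N τ r + V r * (dualChange a ^ 2 + dualChange b ^ 2)) := by
          gcongr <;> linarith
    · refine (far r h2 a b ha hb).trans ?_
      have : r ^ (-τ) ≤ 1 := rpow_neg_le_one hτ.le (by linarith)
      calc _ ≤ C₂ * 1 * (radialWeight N τ r + V r * (dualChange a ^ 2 + dualChange b ^ 2)) := by
            gcongr
        _ ≤ _ := by gcongr; linarith
  · rw [← hκ]
    -- The radius chosen below is at most 1, so `M + 1` accommodates `a + s` as well as `a` and `b`.
    obtain ⟨C₁, hC₁, near⟩ := near (M + 1) (by positivity)
    obtain ⟨C₂, hC₂, far⟩ := far (M + 1) (by positivity)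
    -- In both tails the difference is estimated by the sum of its two terms, the smallness coming
    -- from `r^(±τ)`. This gives the 2 near zero; near infinity, `f(a+s)² ≤ 9 f(a)² + 9 f(s)²`
    -- together with the second term gives `9 + 1 = 10`.
    obtain ⟨δ', hδ', hnear⟩ := exists_mul_rpow_le hτ (by positivity : 0 ≤ 2 * C₁) hη
    obtain ⟨L', hL', hfar⟩ := exists_mul_rpow_neg_le hτ (by positivity : 0 ≤ 10 * C₂) hη
    set δ := min δ₀ δ' with hδ
    have hδ0 : 0 < δ := lt_min hδ₀ hδ'
    set L := max L₀ L' with hL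
    obtain ⟨C₃, hC₃, mid⟩ := exists_le_mul_radialWeight (N := N) (τ := τ) hW hδ0 L
    set m := (M + 1) * δ ^ (-κ) with hm
    have hm0 : 0 < m := by positivity
    have huc := (isCompact_Icc (a := -m) (b := m)).uniformContinuousOn_of_continuous
      hφ.continuousOn
    rw [Metric.uniformContinuousOn_iff] at huc
    obtain ⟨ν, hν, huc⟩ := huc (η / (C₃ * m + 1)) (by positivity)
    -- The second entry keeps `|s| ≤ ν/2` for `r ≥ δ`, so uniform continuity applies on the annulus.
    -- The constant `9 C₂` collects the `f(s)²` left over near infinity.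
    refine ⟨min 1 (ν / (2 * δ ^ (-κ))), by positivity, 9 * C₂, by positivity,
      fun r hr a b s ha hb hs => ?_⟩
    have hrκ : 0 < r ^ (-κ) := Real.rpow_pos_of_pos hr _
    have hP := radialWeight_nonneg N τ hr.le
    have hV := hV0 r hr
    have hw0 := hW0 r hr
    have hVf : 0 ≤ V r * (dualChange a ^ 2 + dualChange b ^ 2) := by positivity
    have hVs : 0 ≤ 9 * C₂ * (V r * dualChange s ^ 2) := by positivity
    have hs1 : |s| ≤ 1 * r ^ (-κ) := hs.trans (by gcongr; exact min_le_left _ _)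
    have has : |a + s| ≤ (M + 1) * r ^ (-κ) := by
      refine (abs_add_le a s).trans ?_
      linarith
    have ha1 : |a| ≤ (M + 1) * r ^ (-κ) := by linarith
    have hb1 : |b| ≤ (M + 1) * r ^ (-κ) := by linarith
    have htri : W r * (|φ (a + s) - φ a| * |b|) ≤
        W r * (|φ (a + s)| * |b|) + W r * (|φ a| * |b|) := by
      rw [← mul_add, ← add_mul]
      gcongr
      exact abs_sub _ _
    rcases lt_or_ge r δ with h1 | h1
    · obtain ⟨h1, h1'⟩ := lt_min_iff.1 h1
      have e1 := near r hr h1 (a + s) b has hb1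
      have e2 := near r hr h1 a b ha1 hb1
      have e3 := hnear r hr h1'.le
      calc _ ≤ 2 * C₁ * r ^ τ * radialWeight N τ r := by linarith
        _ ≤ η * radialWeight N τ r := by gcongr
        _ ≤ _ := by
          rw [mul_add]
          have := mul_nonneg hη.le hVf
          linarith
    rcases le_or_gt r L with h2 | h2
    · have ha' : |a| ≤ m := ha1.trans (mul_rpow_neg_le (by linarith) hκ0 hδ0 h1)
      have has' : |a + s| ≤ m := has.trans (mul_rpow_neg_le (by linarith) hκ0 hδ0 h1)
      have hb' : |b| ≤ m := hb1.trans (mul_rpow_neg_le (by linarith) hκ0 hδ0 h1)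
      have hs' : |s| < ν := by
        have hδκ : 0 < δ ^ (-κ) := Real.rpow_pos_of_pos hδ0 _
        calc |s| ≤ ν / (2 * δ ^ (-κ)) * r ^ (-κ) :=
              hs.trans (by gcongr; exact min_le_right _ _)
          _ ≤ ν / (2 * δ ^ (-κ)) * δ ^ (-κ) := mul_rpow_neg_le (by positivity) hκ0 hδ0 h1
          _ = ν / 2 := by field_simp
          _ < ν := by linarith
      have hφs := huc (a + s) (abs_le.1 has') a (abs_le.1 ha') (by
        rwa [Real.dist_eq, add_sub_cancel_left])
      rw [Real.dist_eq] at hφs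
      have hw := mid r h1 h2
      calc _ ≤ C₃ * radialWeight N τ r * (η / (C₃ * m + 1) * m) := by gcongr
        _ = η * radialWeight N τ r * ((C₃ * m) / (C₃ * m + 1)) := by ring
        _ ≤ η * radialWeight N τ r * 1 := by
          gcongr
          rw [div_le_one (by positivity)]
          linarith
        _ ≤ _ := by
          rw [mul_one, mul_add]
          have := mul_nonneg hη.le hVf
          linarith
    · obtain ⟨h2, h2'⟩ := max_lt_iff.1 h2
      have e1 := far r h2 (a + s) b has hb1
      have e2 := far r h2 a b ha1 hb1
      have e3 := hfar r h2'.le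
      have e4 : r ^ (-τ) ≤ 1 := rpow_neg_le_one hτ.le (by linarith)
      have e5 := change_sq_add_le a s
      have hrτ : 0 < r ^ (-τ) := Real.rpow_pos_of_pos hr _
      calc _ ≤ C₂ * r ^ (-τ) * (radialWeight N τ r +
              V r * (dualChange (a + s) ^ 2 + dualChange b ^ 2)) + C₂ * r ^ (-τ) *
              (radialWeight N τ r + V r * (dualChange a ^ 2 + dualChange b ^ 2)) := by linarith
        _ ≤ C₂ * r ^ (-τ) * (radialWeight N τ r +
              V r * ((9 * dualChange a ^ 2 + 9 * dualChange s ^ 2) + dualChange b ^ 2)) +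
              C₂ * r ^ (-τ) *
              (radialWeight N τ r + V r * (dualChange a ^ 2 + dualChange b ^ 2)) := by gcongr
        _ = 10 * C₂ * r ^ (-τ) * (radialWeight N τ r +
              V r * (dualChange a ^ 2 + dualChange b ^ 2)) -
              C₂ * r ^ (-τ) * (8 * (radialWeight N τ r + V r * dualChange b ^ 2)) +
              9 * (C₂ * r ^ (-τ)) * (V r * dualChange s ^ 2) := by ring
        _ ≤ η * (radialWeight N τ r + V r * (dualChange a ^ 2 + dualChange b ^ 2)) - 0 +
              9 * (C₂ * 1) * (V r * dualChange s ^ 2) := by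
          gcongr
          positivity
        _ = _ := by ring

/-- The potential `V` with the nonlinearity `f f'`. -/
theorem admissibleIntegrand_potential {N : ℕ} [hN : Fact (3 ≤ N)] {V : ℝ → ℝ} {τ : ℝ}
    (hτ : 0 < τ) (hτ' : 2 * τ ≤ ((N : ℝ) - 2) / 2) (hVc : ContinuousOn V (Ioi 0))
    (hV0 : ∀ r > 0, 0 ≤ V r) (hVsing : ∃ C > 0, ∀ r ∈ Ioo (0 : ℝ) 1, V r ≤ C / r ^ 2) :
    AdmissibleIntegrand N V τ V (fun t => dualChange t * deriv dualChange t)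
      (fun t => 1 / 2 * dualChange t ^ 2) := by
  have h3 : (3 : ℝ) ≤ N := by exact_mod_cast hN.out
  obtain ⟨C, hC, hVC⟩ := hVsing
  set κ := ((N : ℝ) - 2) / 2 with hκ
  have hκ0 : 0 ≤ κ := by linarith
  -- Since `f f'` is bounded, `V |b|` alone has to be integrable near zero. It is of order
  -- `r^(-κ-2)`, and `2τ ≤ κ = N - 2 - κ` leaves a spare factor `r^τ`.
  have near : ∀ M > 0, ∀ r > 0, r < 1 → ∀ b : ℝ, |b| ≤ M * r ^ (-κ) →
      V r * |b| ≤ C * M * r ^ τ * radialWeight N τ r := by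
    intro M hM r hr hr1 b hb
    have hV := hV0 r hr
    have e : r ^ (-κ) / r ^ 2 = r ^ (-κ - 2) := by
      rw [Real.rpow_sub hr]
      norm_num
    calc _ ≤ C / r ^ 2 * (M * r ^ (-κ)) := by
          gcongr
          exact hVC r ⟨hr, hr1⟩
      _ = C * M * r ^ (-κ - 2) := by rw [← e]; ring
      _ ≤ C * M * r ^ (τ + (τ - N)) := by
          have := Real.rpow_le_rpow_of_exponent_ge hr hr1.le
            (by linarith : τ + (τ - N) ≤ -κ - 2)
          gcongr
      _ = _ := by rw [radialWeight_of_le_one hτ.le hr hr1.le, Real.rpow_add hr]; ring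
  refine ⟨hVc, hV0, continuous_change.mul continuous_deriv_change, hasDerivAt_half_change_sq,
    by simp [change_zero], fun M hM => ?_, fun M hM η hη => ?_⟩
  · rw [← hκ]
    obtain ⟨c, hc, hcf⟩ := exists_sq_le_mul_change_sq M
    refine ⟨C * M + c, by positivity, fun r hr a b ha hb => ?_⟩
    have hP := radialWeight_nonneg N τ hr.le
    have hV := hV0 r hr
    have hVf : 0 ≤ V r * (dualChange a ^ 2 + dualChange b ^ 2) := by positivity
    have h0 : |dualChange a * deriv dualChange a| ≤ |a| := by
      simpa [change_zero] using abs_sub_change_mul_deriv_le 0 a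
    have h1 := abs_change_mul_deriv_le a
    rcases lt_or_ge r 1 with hr1 | hr1
    · have hrτ : r ^ τ ≤ 1 := Real.rpow_le_one hr.le hr1.le hτ.le
      calc _ ≤ V r * (1 * |b|) := by gcongr
        _ ≤ C * M * r ^ τ * radialWeight N τ r := by
          rw [one_mul]
          exact near M hM r hr hr1 b hb
        _ ≤ C * M * 1 * radialWeight N τ r := by gcongr
        _ ≤ (C * M + c) *
            (radialWeight N τ r + V r * (dualChange a ^ 2 + dualChange b ^ 2)) := by
          rw [mul_one]
          gcongr <;> linarith
    · have hrκ := mul_le_mul_of_nonneg_left (rpow_neg_le_one hκ0 hr1) hM.le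
      have ha' := hcf a (by linarith)
      have hb' := hcf b (by linarith)
      have hab : |a| * |b| ≤ a ^ 2 + b ^ 2 := by
        rw [← sq_abs a, ← sq_abs b]
        nlinarith [sq_nonneg (|a| - |b|), sq_nonneg |a|, sq_nonneg |b|]
      calc _ ≤ V r * (|a| * |b|) := by gcongr
        _ ≤ V r * (c * dualChange a ^ 2 + c * dualChange b ^ 2) := by
          gcongr
          linarith
        _ = c * (V r * (dualChange a ^ 2 + dualChange b ^ 2)) := by ring
        _ ≤ _ := by
          have : 0 ≤ C * M := by positivity
          gcongr <;> linarith
  · rw [← hκ]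
    obtain ⟨δ', hδ', hnear⟩ := exists_mul_rpow_le hτ (by positivity : 0 ≤ 2 * (C * M)) hη
    set δ := min 1 δ' with hδ
    have hδ0 : 0 < δ := lt_min one_pos hδ'
    obtain ⟨c, hc, hcf⟩ := exists_sq_le_mul_change_sq ((M + 1) * δ ^ (-κ))
    -- For `r ≥ δ` the Lipschitz bound on `f f'` leaves `V |s| |b|`. Young's inequality with weight
    -- `η/c`, followed by `t² ≤ c f(t)²`, gives the coefficients `η` for `b` and `c²/η` for `s`.
    refine ⟨1, one_pos, c * (c / η), by positivity, fun r hr a b s ha hb hs => ?_⟩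
    have hrκ : 0 < r ^ (-κ) := Real.rpow_pos_of_pos hr _
    have hP := radialWeight_nonneg N τ hr.le
    have hV := hV0 r hr
    have hVs : 0 ≤ c * (c / η) * (V r * dualChange s ^ 2) := by positivity
    set d := |dualChange (a + s) * deriv dualChange (a + s) - dualChange a * deriv dualChange a|
      with hd
    have hd1 : d ≤ |s| := by
      have := abs_sub_change_mul_deriv_le a (a + s)
      rwa [add_sub_cancel_left] at this
    have hd2 : d ≤ 2 := by
      refine (abs_sub _ _).trans ?_
      linarith [abs_change_mul_deriv_le a, abs_change_mul_deriv_le (a + s)]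
    rcases lt_or_ge r δ with h1 | h1
    · obtain ⟨h1, h1'⟩ := lt_min_iff.1 h1
      have e1 := near M hM r hr h1 b hb
      have e2 := hnear r hr h1'.le
      calc V r * (d * |b|) ≤ V r * (2 * |b|) := by gcongr
        _ ≤ 2 * (C * M) * r ^ τ * radialWeight N τ r := by linarith
        _ ≤ η * radialWeight N τ r := by gcongr
        _ ≤ _ := by
          rw [mul_add]
          have : 0 ≤ η * (V r * (dualChange a ^ 2 + dualChange b ^ 2)) := by positivity
          linarith
    · have hb' := hcf b ((show |b| ≤ (M + 1) * r ^ (-κ) by linarith).trans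
        (mul_rpow_neg_le (by linarith) hκ0 hδ0 h1))
      have hs' := hcf s ((show |s| ≤ (M + 1) * r ^ (-κ) by nlinarith).trans
        (mul_rpow_neg_le (by linarith) hκ0 hδ0 h1))
      have hsb : |s| * |b| ≤ η / c * b ^ 2 + c / η * s ^ 2 := by
        have h := sq_nonneg (η * |b| - c * |s|)
        rw [← sq_abs b, ← sq_abs s, div_mul_eq_mul_div, div_mul_eq_mul_div,
          div_add_div _ _ hc.ne' hη.ne', le_div_iff₀ (by positivity)]
        nlinarith [mul_nonneg (mul_nonneg hc.le hη.le) (mul_nonneg (abs_nonneg s) (abs_nonneg b))]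
      calc V r * (d * |b|) ≤ V r * (|s| * |b|) := by gcongr
        _ ≤ V r * (η / c * (c * dualChange b ^ 2) + c / η * (c * dualChange s ^ 2)) := by
          gcongr
          refine hsb.trans ?_
          gcongr
        _ = η * (V r * dualChange b ^ 2) + c * (c / η) * (V r * dualChange s ^ 2) := by
          field_simp
        _ ≤ _ := by
          have e1 : 0 ≤ V r * dualChange a ^ 2 := by positivity
          gcongr
          linarith

/-- One factor `|f|` is absorbed by `f'`, since `|f| f' ≤ 1`; the remaining `|f|^(q-2)` is a power
of `f² ≤ 2|a|`. The growth exponent is thereby halved. -/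
theorem abs_change_rpow_mul_deriv_le {q : ℝ} (hq : 2 < q) (a : ℝ) :
    |dualChange a| ^ (q - 1) * deriv dualChange a ≤ (2 * |a|) ^ ((q - 2) / 2) := by
  have e : |dualChange a| ^ (q - 1) = |dualChange a| ^ (q - 2) * |dualChange a| := by
    rw [← Real.rpow_add_one' (abs_nonneg _) (by linarith)]
    congr 1
    ring
  have e2 : |dualChange a| ^ (q - 2) = (dualChange a ^ 2) ^ ((q - 2) / 2) := by
    rw [← sq_abs, ← Real.rpow_natCast, ← Real.rpow_mul (abs_nonneg _)]
    congr 1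
    push_cast
    ring
  calc _ = |dualChange a| ^ (q - 2) * (|dualChange a| * deriv dualChange a) := by
        rw [e, mul_assoc]
    _ ≤ |dualChange a| ^ (q - 2) * 1 := by
        gcongr
        exact abs_change_mul_deriv_le_one a
    _ = (dualChange a ^ 2) ^ ((q - 2) / 2) := by rw [mul_one, e2]
    _ ≤ _ := by
        gcongr
        exact change_sq_le_two_mul_abs a

/-- Weighted AM-GM, with the weights then bounded by 1. -/
theorem rpow_mul_rpow_one_sub_le_add {x y β : ℝ} (hx : 0 ≤ x) (hy : 0 ≤ y) (hβ : β ∈ Icc (0 : ℝ) 1) :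
    x ^ β * y ^ (1 - β) ≤ x + y := by
  obtain ⟨h0, h1⟩ := hβ
  have h := Real.geom_mean_le_arith_mean2_weighted h0 (sub_nonneg.2 h1) hx hy (by ring)
  nlinarith

/-- Estimate of the nonlinear term near the origin. -/
theorem exists_near_bound {N : ℕ} {V K g : ℝ → ℝ} {τ κ α β q C Cv R Cg : ℝ} (hτ : 0 ≤ τ)
    (hV0 : ∀ r > 0, 0 ≤ V r) (hCv : 0 ≤ Cv) (hVs : ∀ r ∈ Ioo (0 : ℝ) 1, V r ≤ Cv / r ^ 2)
    (hβ : 0 ≤ β) (hK : ∀ r ∈ Ioo (0 : ℝ) R, K r ≤ C * (r ^ α * V r ^ β)) (hq : 2 < q)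
    (hCg : 0 ≤ Cg) (hg : ∀ t, |g t| ≤ Cg * |t| ^ (q - 1))
    (hexp : 2 * τ ≤ α - 2 * β - κ * (q / 2) + N) {M : ℝ} (hM : 0 ≤ M) :
    ∃ C', 0 ≤ C' ∧ ∀ r > 0, r < min R 1 → ∀ a b : ℝ, |a| ≤ M * r ^ (-κ) → |b| ≤ M * r ^ (-κ) →
      K r * (|g (dualChange a) * deriv dualChange a| * |b|) ≤ C' * r ^ τ * radialWeight N τ r := by
  refine ⟨|C| * Cv ^ β * (Cg * (2 * M) ^ ((q - 2) / 2) * M), by positivity,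
    fun r hr hrR a b ha hb => ?_⟩
  obtain ⟨hrR, hr1⟩ := lt_min_iff.1 hrR
  have hV := hV0 r hr
  have hK' : K r ≤ |C| * Cv ^ β * r ^ (α - 2 * β) := by
    have e : r ^ (α - 2 * β) = r ^ α * ((r ^ 2) ^ β)⁻¹ := by
      rw [Real.rpow_sub hr, div_eq_mul_inv, ← Real.rpow_natCast, ← Real.rpow_mul hr.le]
      norm_num
    calc K r ≤ C * (r ^ α * V r ^ β) := hK r ⟨hr, hrR⟩
      _ ≤ |C| * (r ^ α * V r ^ β) := by
        gcongr
        exact le_abs_self C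
      _ ≤ |C| * (r ^ α * (Cv / r ^ 2) ^ β) := by
        gcongr
        exact hVs r ⟨hr, hr1⟩
      _ = _ := by
        rw [Real.div_rpow hCv (by positivity), e]
        ring
  have hg' : |g (dualChange a) * deriv dualChange a| * |b| ≤
      Cg * (2 * M) ^ ((q - 2) / 2) * M * r ^ (-κ * (q / 2)) := by
    have hd := deriv_change_pos a
    have e : r ^ (-κ * (q / 2)) = (r ^ (-κ)) ^ ((q - 2) / 2) * r ^ (-κ) := by
      rw [← Real.rpow_mul hr.le, ← Real.rpow_add hr]
      congr 1
      ring
    rw [abs_mul, abs_of_pos hd]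
    have h2 : (2 * |a|) ^ ((q - 2) / 2) ≤ (2 * M * r ^ (-κ)) ^ ((q - 2) / 2) :=
      Real.rpow_le_rpow (by positivity) (by linarith) (by linarith)
    calc _ ≤ Cg * |dualChange a| ^ (q - 1) * deriv dualChange a * (M * r ^ (-κ)) := by
          gcongr
          exact hg _
      _ = Cg * (|dualChange a| ^ (q - 1) * deriv dualChange a) * (M * r ^ (-κ)) := by ring
      _ ≤ Cg * (2 * M * r ^ (-κ)) ^ ((q - 2) / 2) * (M * r ^ (-κ)) := by
          gcongr
          exact (abs_change_rpow_mul_deriv_le hq a).trans h2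
      _ = _ := by
          rw [Real.mul_rpow (by positivity) (by positivity), e]
          ring
  have hrα : 0 ≤ |C| * Cv ^ β * r ^ (α - 2 * β) := by positivity
  calc _ ≤ |C| * Cv ^ β * r ^ (α - 2 * β) *
        (Cg * (2 * M) ^ ((q - 2) / 2) * M * r ^ (-κ * (q / 2))) := by gcongr
    _ = |C| * Cv ^ β * (Cg * (2 * M) ^ ((q - 2) / 2) * M) * r ^ (α - 2 * β + -κ * (q / 2)) := by
        rw [Real.rpow_add hr]
        ring
    -- Of the slack `2τ`, one `τ` makes the weight integrable and the other remains as a factor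
    -- tending to zero.
    _ ≤ |C| * Cv ^ β * (Cg * (2 * M) ^ ((q - 2) / 2) * M) * r ^ (τ + (τ - N)) := by
        have := Real.rpow_le_rpow_of_exponent_ge hr hr1.le
          (by linarith : τ + (τ - N) ≤ α - 2 * β + -κ * (q / 2))
        gcongr
    _ = _ := by
        rw [radialWeight_of_le_one hτ hr hr1.le, Real.rpow_add hr]
        ring

/-- Estimate of the nonlinear term near infinity. -/
theorem exists_far_bound {N : ℕ} {V K g : ℝ → ℝ} {τ κ α β q C R Cg : ℝ} (hτ : 0 ≤ τ)
    (hκ : 0 ≤ κ) (hV0 : ∀ r > 0, 0 ≤ V r) (hβ : β ∈ Icc (0 : ℝ) 1)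
    (hK : ∀ r > R, K r ≤ C * (r ^ α * V r ^ β)) (hq : 2 < q)
    (hCg : 0 ≤ Cg) (hg : ∀ t, |g t| ≤ Cg * |t| ^ (q - 1))
    (hexp : 2 * τ ≤ κ * (q - 2 * β) - α - N * (1 - β)) {M : ℝ} (hM : 0 ≤ M) :
    ∃ C', 0 ≤ C' ∧ ∀ r > max R 1, ∀ a b : ℝ, |a| ≤ M * r ^ (-κ) → |b| ≤ M * r ^ (-κ) →
      K r * (|g (dualChange a) * deriv dualChange a| * |b|) ≤ C' * r ^ (-τ) *
        (radialWeight N τ r + V r * (dualChange a ^ 2 + dualChange b ^ 2)) := by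
  obtain ⟨c, hc, hcf⟩ := exists_sq_le_mul_change_sq M
  have hβ0 := hβ.1
  have hβ1 := hβ.2
  refine ⟨|C| * Cg * (M ^ (q - 1 - β) * M ^ (1 - β)) * (1 + c), by positivity,
    fun r hrR a b ha hb => ?_⟩
  obtain ⟨hrR, hr1⟩ := max_lt_iff.1 hrR
  have hr : 0 < r := one_pos.trans hr1
  have hV := hV0 r hr
  have hP := radialWeight_nonneg N τ hr.le
  have hrκ := mul_le_mul_of_nonneg_left (rpow_neg_le_one hκ hr1.le) hM
  have ha' := hcf a (by linarith)
  have hb' := hcf b (by linarith)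
  have hK' : K r ≤ |C| * (r ^ α * V r ^ β) := (hK r hrR).trans (by
    gcongr
    exact le_abs_self C)
  have hg' : |g (dualChange a) * deriv dualChange a| ≤ Cg * |a| ^ (q - 1) := by
    rw [abs_mul, abs_of_pos (deriv_change_pos a)]
    calc _ ≤ Cg * |dualChange a| ^ (q - 1) * 1 :=
          mul_le_mul (hg _) (deriv_change_le_one a) (deriv_change_pos a).le (by positivity)
      _ ≤ Cg * |a| ^ (q - 1) := by
          rw [mul_one]
          have := Real.rpow_le_rpow (abs_nonneg _) (abs_change_le a)
            (by linarith : 0 ≤ q - 1)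
          gcongr
  -- A power `β` of `|a|` and of `|b|` is set aside to join `V^β` as `(V |a| |b|)^β`; the radial
  -- decay is spent only on the remaining powers.
  have eA : |a| ^ (q - 1) = |a| ^ β * |a| ^ (q - 1 - β) := by
    rw [← Real.rpow_add' (abs_nonneg a) (by linarith)]
    congr 1
    ring
  have eB : |b| = |b| ^ β * |b| ^ (1 - β) := by
    rw [← Real.rpow_add' (abs_nonneg b) (by norm_num)]
    norm_num
  have hA : |a| ^ (q - 1 - β) ≤ M ^ (q - 1 - β) * r ^ (-κ * (q - 1 - β)) := by
    rw [Real.rpow_mul hr.le, ← Real.mul_rpow hM (by positivity)]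
    exact Real.rpow_le_rpow (abs_nonneg a) ha (by linarith)
  have hB : |b| ^ (1 - β) ≤ M ^ (1 - β) * r ^ (-κ * (1 - β)) := by
    rw [Real.rpow_mul hr.le, ← Real.mul_rpow hM (by positivity)]
    exact Real.rpow_le_rpow (abs_nonneg b) hb (by linarith)
  have hpow : r ^ α * (r ^ (-κ * (q - 1 - β)) * r ^ (-κ * (1 - β))) ≤
      r ^ (-τ) * radialWeight N τ r ^ (1 - β) := by
    rw [radialWeight_of_one_le hτ hr1.le, ← Real.rpow_mul hr.le, ← Real.rpow_add hr,
      ← Real.rpow_add hr, ← Real.rpow_add hr]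
    refine Real.rpow_le_rpow_of_exponent_le hr1.le ?_
    have : 0 ≤ τ * β := by positivity
    nlinarith
  have hab : V r * (|a| * |b|) ≤ c * (V r * (dualChange a ^ 2 + dualChange b ^ 2)) := by
    have h : |a| * |b| ≤ a ^ 2 + b ^ 2 := by
      rw [← sq_abs a, ← sq_abs b]
      nlinarith [sq_nonneg (|a| - |b|), sq_nonneg |a|, sq_nonneg |b|]
    calc _ ≤ V r * (c * dualChange a ^ 2 + c * dualChange b ^ 2) := by
          gcongr
          linarith
      _ = _ := by ring
  have hy := rpow_mul_rpow_one_sub_le_add (by positivity : 0 ≤ V r * (|a| * |b|)) hP hβ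
  have hx : 0 ≤ V r * (dualChange a ^ 2 + dualChange b ^ 2) := by positivity
  have hrτ : 0 < r ^ (-τ) := Real.rpow_pos_of_pos hr _
  calc _ ≤ |C| * (r ^ α * V r ^ β) * (Cg * |a| ^ (q - 1) * |b|) := by gcongr
    _ = |C| * Cg * (r ^ α * (V r ^ β * |a| ^ β * |b| ^ β) *
          (|a| ^ (q - 1 - β) * |b| ^ (1 - β))) := by
        rw [eA]
        nth_rewrite 1 [eB]
        ring
    _ ≤ |C| * Cg * (r ^ α * (V r ^ β * |a| ^ β * |b| ^ β) *
          ((M ^ (q - 1 - β) * r ^ (-κ * (q - 1 - β))) *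
            (M ^ (1 - β) * r ^ (-κ * (1 - β))))) := by gcongr
    _ = |C| * Cg * (M ^ (q - 1 - β) * M ^ (1 - β)) * ((V r * (|a| * |b|)) ^ β *
          (r ^ α * (r ^ (-κ * (q - 1 - β)) * r ^ (-κ * (1 - β))))) := by
        rw [Real.mul_rpow hV (by positivity), Real.mul_rpow (abs_nonneg a) (abs_nonneg b)]
        ring
    _ ≤ |C| * Cg * (M ^ (q - 1 - β) * M ^ (1 - β)) * ((V r * (|a| * |b|)) ^ β *
          (r ^ (-τ) * radialWeight N τ r ^ (1 - β))) := by gcongr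
    _ = |C| * Cg * (M ^ (q - 1 - β) * M ^ (1 - β)) * r ^ (-τ) * ((V r * (|a| * |b|)) ^ β *
          radialWeight N τ r ^ (1 - β)) := by ring
    _ ≤ |C| * Cg * (M ^ (q - 1 - β) * M ^ (1 - β)) * r ^ (-τ) * ((1 + c) * (radialWeight N τ r +
          V r * (dualChange a ^ 2 + dualChange b ^ 2))) := by
        have h1 := mul_nonneg hc.le hP
        refine mul_le_mul_of_nonneg_left (hy.trans ?_) (by positivity)
        linarith
    _ = _ := by ring

/-! ### The gradient term -/

namespace OrliczSobolev

variable {N : ℕ} [hN : Fact (3 ≤ N)] {V : ℝ → ℝ}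

/-- The gradient as a continuous linear map `E → L²`. -/
noncomputable def gradL (N : ℕ) [Fact (3 ≤ N)] (V : ℝ → ℝ) : OrliczSobolev N V →L[ℝ]
    Lp (EuclideanSpace ℝ (Fin N)) 2 (volume : Measure (EuclideanSpace ℝ (Fin N))) :=
  LinearMap.mkContinuous
    { toFun := fun u => u.1.1.2
      map_add' := fun _ _ => rfl
      map_smul' := fun _ _ => rfl } 1 fun u => by
    rw [one_mul]
    exact (gradNorm_eq u).symm.trans_le (gradNorm_le_norm u)

theorem inner_gradL (u v : OrliczSobolev N V) :
    inner ℝ (gradL N V u) (gradL N V v) = ∫ x, inner ℝ (u.grad x) (v.grad x) :=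
  L2.inner_def _ _

theorem integrable_inner_grad (u v : OrliczSobolev N V) :
    Integrable (fun x => inner ℝ (u.grad x) (v.grad x)) volume :=
  L2.integrable_inner (𝕜 := ℝ) u.1.1.2 v.1.1.2

theorem norm_gradL_sq (u : OrliczSobolev N V) : ‖gradL N V u‖ ^ 2 = ∫ x, ‖u.grad x‖ ^ 2 :=
  norm_sq_eq_integral _

/-- The differential of `½ ∫ |∇u|²`. -/
noncomputable def gradDifferential (N : ℕ) [Fact (3 ≤ N)] (V : ℝ → ℝ) (u : OrliczSobolev N V) :
    OrliczSobolev N V →L[ℝ] ℝ :=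
  (innerSL ℝ (gradL N V u)).comp (gradL N V)

theorem gradDifferential_apply (u h : OrliczSobolev N V) :
    gradDifferential N V u h = ∫ x, inner ℝ (u.grad x) (h.grad x) :=
  inner_gradL u h

theorem continuous_gradDifferential : Continuous (gradDifferential N V) := by
  unfold gradDifferential
  fun_prop

theorem hasFDerivAt_half_grad_sq (u : OrliczSobolev N V) :
    HasFDerivAt (fun u : OrliczSobolev N V => 1 / 2 * ∫ x, ‖u.grad x‖ ^ 2)
      (gradDifferential N V u) u := by
  have h := ((gradL N V).hasFDerivAt (x := u)).norm_sq.const_mul (1 / 2)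
  simp only [norm_gradL_sq] at h
  refine h.congr_fderiv ?_
  ext v
  simp [gradDifferential]

end OrliczSobolev

/-! ### The exponents and the assembly of the energy -/

theorem hasDerivAt_primitive_change {g : ℝ → ℝ} (hg : Continuous g) (t : ℝ) :
    HasDerivAt (fun t => primitive g (dualChange t)) (g (dualChange t) * deriv dualChange t) t := by
  have h : HasDerivAt (primitive g) (g (dualChange t)) (dualChange t) :=
    intervalIntegral.integral_hasDerivAt_right (hg.intervalIntegrable _ _)
      hg.aestronglyMeasurable.stronglyMeasurableAtFilter hg.continuousAt
  exact h.comp t (hasDerivAt_change t).differentiableAt.hasDerivAt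

theorem exists_admissibleIntegrand {N : ℕ} [hN : Fact (3 ≤ N)] {V K g : ℝ → ℝ}
    (hVcont : ContinuousOn V (Ioi 0)) (hVnonneg : ∀ r > 0, 0 ≤ V r)
    (hKcont : ContinuousOn K (Ioi 0)) (hKpos : ∀ r > 0, 0 < K r)
    (hVsing : ∃ C > 0, ∀ r ∈ Ioo (0 : ℝ) 1, V r ≤ C / r ^ 2) {α₀ β₀ αinf βinf : ℝ}
    (hβ₀ : β₀ ∈ Icc (0 : ℝ) 1) (hβinf : βinf ∈ Icc (0 : ℝ) 1)
    (hzero : ∃ R₁ > 0, ∃ C, ∀ r ∈ Ioo (0 : ℝ) R₁, K r ≤ C * (r ^ α₀ * V r ^ β₀))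
    (hinf : ∃ R₂ > 0, ∃ C, ∀ r > R₂, K r ≤ C * (r ^ αinf * V r ^ βinf)) {q₁ q₂ : ℝ}
    (hq₁ : 4 < q₁ ∧ q₁ < 2 * qZero N α₀ β₀) (hq₂ : max 4 (2 * qInfty N αinf βinf) < q₂)
    (hg₁ : Continuous g)
    (hgq : ∃ C > 0, ∀ t : ℝ, |g t| ≤ C * min (|t| ^ (q₁ - 1)) (|t| ^ (q₂ - 1))) :
    ∃ τ > 0,
      AdmissibleIntegrand N V τ V (fun t => dualChange t * deriv dualChange t)
        (fun t => 1 / 2 * dualChange t ^ 2) ∧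
      AdmissibleIntegrand N V τ K (fun t => g (dualChange t) * deriv dualChange t)
        (fun t => primitive g (dualChange t)) := by
  have h3 : (3 : ℝ) ≤ N := by exact_mod_cast hN.out
  obtain ⟨Cv, hCv, hVs⟩ := id hVsing
  obtain ⟨R₁, hR₁, C₁, hK₁⟩ := hzero
  obtain ⟨R₂, hR₂, C₂, hK₂⟩ := hinf
  obtain ⟨Cg, hCg, hg⟩ := hgq
  obtain ⟨hq₂, hq₂'⟩ := max_lt_iff.1 hq₂
  obtain ⟨hq₁, hq₁'⟩ := hq₁
  set κ := ((N : ℝ) - 2) / 2 with hκ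
  have hκ0 : 0 < κ := by linarith
  have hN2 : (N : ℝ) = 2 * κ + 2 := by linarith
  set s₁ := α₀ - 2 * β₀ - κ * (q₁ / 2) + N with hs₁
  set s₂ := κ * (q₂ - 2 * βinf) - αinf - N * (1 - βinf) with hs₂
  have hs₁0 : 0 < s₁ := by
    rw [qZero, mul_div_assoc', lt_div_iff₀ (by linarith)] at hq₁'
    -- The requirement on `q₁` is stronger than `s₁ > 0` by the margin `β₀ κ ≥ 0`.
    have := mul_nonneg hβ₀.1 hκ0.le
    rw [hN2] at hq₁' hs₁
    rw [hs₁]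
    linarith
  have hs₂0 : 0 < s₂ := by
    have h1 : 2 * (αinf + N - 2 * βinf) < κ * q₂ := by
      rw [qInfty, mul_div_assoc', mul_div_assoc', div_lt_iff₀ (by linarith)] at hq₂'
      rw [hN2] at hq₂' ⊢
      linarith
    -- Here `s₂ = κ q₂ - (αinf + N - 2 βinf)`, and the subtracted quantity is below `κ q₂ / 2`, so
    -- positivity of `κ q₂` finishes, whatever its sign.
    have h2 : 0 < κ * q₂ := by positivity
    rw [hN2] at h1 hs₂
    rw [hs₂]
    linarith
  -- Half of the least slack among the potential term, the origin and infinity: each estimate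
  -- consumes `2τ`.
  set τ := min κ (min s₁ s₂) / 2 with hτ
  have hm : 0 < min κ (min s₁ s₂) := lt_min hκ0 (lt_min hs₁0 hs₂0)
  have hτ0 : 0 < τ := by positivity
  have h2τ : 2 * τ = min κ (min s₁ s₂) := by rw [hτ]; ring
  have hτκ : 2 * τ ≤ κ := h2τ.trans_le (min_le_left _ _)
  have hτ₁ : 2 * τ ≤ s₁ := h2τ.trans_le ((min_le_right _ _).trans (min_le_left _ _))
  have hτ₂ : 2 * τ ≤ s₂ := h2τ.trans_le ((min_le_right _ _).trans (min_le_right _ _))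
  refine ⟨τ, hτ0, admissibleIntegrand_potential hτ0 hτκ hVcont hVnonneg hVsing, ?_⟩
  refine AdmissibleIntegrand.of_tails hκ hτ0 hVnonneg hKcont (fun r hr => (hKpos r hr).le)
    ((hg₁.comp continuous_change).mul continuous_deriv_change) (hasDerivAt_primitive_change hg₁)
    (by simp [primitive, change_zero]) (δ₀ := min R₁ 1) (L₀ := max R₂ 1)
    (lt_min hR₁ one_pos) (min_le_right _ _) (le_max_right _ _) (fun M hM => ?_) (fun M hM => ?_)
  · exact exists_near_bound hτ0.le hVnonneg hCv.le hVs hβ₀.1 hK₁ (by linarith) hCg.le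
      (fun t => (hg t).trans (by gcongr; exact min_le_left _ _)) hτ₁ hM.le
  · exact exists_far_bound hτ0.le hκ0.le hVnonneg hβinf hK₂ (by linarith) hCg.le
      (fun t => (hg t).trans (by gcongr; exact min_le_right _ _)) hτ₂ hM.le

end QuasilinearDual

theorem theorem3p2 (N : ℕ) [Fact (3 ≤ N)] (V K g : ℝ → ℝ)
    -- the potentials
    (hVcont : ContinuousOn V (Ioi 0)) (hVnonneg : ∀ r > 0, 0 ≤ V r)
    (hKcont : ContinuousOn K (Ioi 0)) (hKpos : ∀ r > 0, 0 < K r)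
    (hVsing : ∃ C > 0, ∀ r ∈ Ioo (0 : ℝ) 1, V r ≤ C / r ^ 2)
    -- the ratio of the potentials near zero and near infinity (with `0 ^ 0 = 1`)
    (α₀ β₀ αinf βinf : ℝ)
    (hβ₀ : β₀ ∈ Icc (0 : ℝ) 1) (hβinf : βinf ∈ Icc (0 : ℝ) 1)
    (hzero : ∃ R₁ > 0, ∃ C, ∀ r ∈ Ioo (0 : ℝ) R₁, K r ≤ C * (r ^ α₀ * V r ^ β₀))
    (hinf : ∃ R₂ > 0, ∃ C, ∀ r > R₂, K r ≤ C * (r ^ αinf * V r ^ βinf))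
    -- the exponents
    (q₁ q₂ : ℝ)
    (hq₁ : 4 < q₁ ∧ q₁ < 2 * qZero N α₀ β₀)
    (hq₂ : max 4 (2 * qInfty N αinf βinf) < q₂)
    -- the nonlinearity
    (hg₁ : Continuous g)
    (hg₂ : ∃ θ > 2, ∀ t : ℝ,
      0 ≤ 2 * θ * primitive g t ∧ 2 * θ * primitive g t ≤ g t * t)
    (hg₃ : ∃ t₀ > 0, 0 < primitive g t₀)
    (hgq : ∃ C > 0, ∀ t : ℝ, |g t| ≤ C * min (|t| ^ (q₁ - 1)) (|t| ^ (q₂ - 1))) :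
    -- `I` is well defined: the three integrals converge
    (∀ u : OrliczSobolev N V,
      Integrable (fun x => ‖u.grad x‖ ^ 2) volume ∧
      Integrable (fun x => V ‖x‖ * dualChange (u.fn x) ^ 2) volume ∧
      Integrable (fun x => K ‖x‖ *
        primitive g (dualChange (u.fn x))) volume) ∧
    -- `I` is continuous
    Continuous (energy (N := N) V K g) ∧
    -- `I` is of class `C¹` (in the sense of Fréchet)
    ContDiff ℝ 1 (energy (N := N) V K g) ∧
    -- the formula for the differential, whose integrals converge
    ∀ u h : OrliczSobolev N V,
      Integrable (fun x => inner ℝ (u.grad x) (h.grad x)) volume ∧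
      Integrable (fun x => V ‖x‖ * (dualChange (u.fn x) *
        deriv dualChange (u.fn x) * h.fn x)) volume ∧
      Integrable (fun x => K ‖x‖ * (g (dualChange (u.fn x)) *
        deriv dualChange (u.fn x) * h.fn x)) volume ∧
      fderiv ℝ (energy (N := N) V K g) u h =
        (∫ x, inner ℝ (u.grad x) (h.grad x)) +
        (∫ x, V ‖x‖ * (dualChange (u.fn x) *
          deriv dualChange (u.fn x) * h.fn x)) -
        ∫ x, K ‖x‖ * (g (dualChange (u.fn x)) *
          deriv dualChange (u.fn x) * h.fn x) := by
  obtain ⟨τ, hτ, hP, hQ⟩ := exists_admissibleIntegrand hVcont hVnonneg hKcont hKpos hVsing hβ₀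
    hβinf hzero hinf hq₁ hq₂ hg₁ hgq
  -- The factor `1/2` goes inside the potential integral so that `f²/2`, the primitive of `f f'`,
  -- appears.
  have hE : energy (N := N) V K g = fun u : OrliczSobolev N V =>
      1 / 2 * (∫ x, ‖u.grad x‖ ^ 2) + (∫ x, V ‖x‖ * (1 / 2 * dualChange (u.fn x) ^ 2)) -
        ∫ x, K ‖x‖ * primitive g (dualChange (u.fn x)) := by
    funext u
    rw [energy, ← integral_const_mul (1 / 2 : ℝ) fun x => V ‖x‖ * dualChange (u.fn x) ^ 2]
    simp only [mul_left_comm]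
  have hD : ∀ u : OrliczSobolev N V, HasFDerivAt (energy (N := N) V K g)
      (OrliczSobolev.gradDifferential N V u + hP.differential hτ hVcont hVnonneg u -
        hQ.differential hτ hVcont hVnonneg u) u := fun u => by
    rw [hE]
    exact ((OrliczSobolev.hasFDerivAt_half_grad_sq u).add
      (hP.hasFDerivAt_integral hτ hVcont hVnonneg u)).sub
      (hQ.hasFDerivAt_integral hτ hVcont hVnonneg u)
  have hC1 : ContDiff ℝ 1 (energy (N := N) V K g) := by
    refine contDiff_one_iff_hasFDerivAt.2 ⟨_, ?_, hD⟩
    exact (OrliczSobolev.continuous_gradDifferential.add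
      (hP.continuous_differential hτ hVcont hVnonneg)).sub
      (hQ.continuous_differential hτ hVcont hVnonneg)
  refine ⟨fun u => ⟨?_, OrliczSobolev.integrable_mul_change_sq hVcont hVnonneg u,
    hQ.integrable_primitive hτ hVcont hVnonneg u⟩, hC1.continuous, hC1, fun u h =>
    ⟨OrliczSobolev.integrable_inner_grad u h, hP.integrable_mul hτ hVcont hVnonneg u h,
      hQ.integrable_mul hτ hVcont hVnonneg u h, ?_⟩⟩
  · simpa only [real_inner_self_eq_norm_sq] using OrliczSobolev.integrable_inner_grad u u
  · rw [(hD u).fderiv, _root_.sub_apply, _root_.add_apply,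
      OrliczSobolev.gradDifferential_apply, AdmissibleIntegrand.differential_apply,
      AdmissibleIntegrand.differential_apply]
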